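/- **Formulas.** For a finite set $V$ of Boolean variables, LTL formulas are built from $\mathsf{true}$, $\mathsf{false}$ and the variables $v\in V$ by $\neg,\wedge,\vee$, the future operators $\mathsf X\varphi$, $[\varphi\,\underline{\mathsf U}\,\psi]$, $[\varphi\,\mathsf B\,\psi]$ and the past operators $\overleftarrow{\mathsf X}\varphi$, $\underline{\overleftarrow{\mathsf X}}\varphi$, $[\varphi\,\underline{\overleftarrow{\mathsf U}}\,\psi]$, $[\varphi\,\overleftarrow{\mathsf B}\,\psi]$. They are evaluated at positions $t\in\mathbb N$ of infinite words over the alphabet $2^V$, with the usual meaning of the Boolean operators and of $\mathsf X$ (next), and - $[\varphi\,\underline{\mathsf U}\,\psi]$ holds at $t$ iff $\psi$ holds at some $d\ge t$ and $\varphi$ holds at all $s$ with $t\le s<d$; $[\varphi\,\mathsf B\,\psi]=\neg[(\neg\varphi)\,\underline{\mathsf U}\,\psi]$; - $\underline{\overleftarrow{\mathsf X}}\varphi$ holds at $t$ iff $t>0$ and $\varphi$ holds at $t-1$; $\overleftarrow{\mathsf X}\varphi$ holds at $t$ iff $t=0$ or $\varphi$ holds at $t-1$; - $[\varphi\,\underline{\overleftarrow{\mathsf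 U}}\,\psi]$ holds at $t$ iff $\psi$ holds at some $d\le t$ and $\varphi$ holds at all $s$ with $d<s\le t$; $[\varphi\,\overleftarrow{\mathsf B}\,\psi]=\neg[(\neg\varphi)\,\underline{\overleftarrow{\mathsf U}}\,\psi]$. Abbreviations: $[\varphi\,\mathsf U\,\psi]=[\psi\,\mathsf B\,(\neg\varphi\wedge\neg\psi)]$ (weak until), $[\varphi\,\overleftarrow{\mathsf U}\,\psi]=[\psi\,\overleftarrow{\mathsf B}\,(\neg\varphi\wedge\neg\psi)]$, and $\varphi\to\psi=\neg\varphi\vee\psi$. **Grammar.** For $\kappa\in\{\mathsf G,\mathsf F,\mathsf{GF},\mathsf{FG}\}$ the nonterminal $P_\kappa$ has the productions $P_\kappa\wedge P_\kappa$, $P_\kappa\vee P_\kappa$, $\overleftarrow{\mathsf X}P_\kappa$, $\underline{\overleftarrow{\mathsf X}}P_\kappa$, $[P_\kappa\,\overleftarrow{\mathsf U}\,P_\kappa]$, $[P_\kappa\,\underline{\overleftarrow{\mathsf U}}\,P_\kappa]$, $\mathsf XP_\kappa$, and moreover $$\begin{aligned}P_{\mathsf G}&::= v\mid\neg P_{\mathsf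 F}\mid[P_{\mathsf G}\,\mathsf U\,P_{\mathsf G}], & P_{\mathsf F}&::= v\mid\neg P_{\mathsf G}\mid[P_{\mathsf F}\,\underline{\mathsf U}\,P_{\mathsf F}],\\ P_{\mathsf{GF}}&::= P_{\mathsf{Prefix}}\mid\neg P_{\mathsf{FG}}\mid[P_{\mathsf{GF}}\,\mathsf U\,P_{\mathsf{GF}}]\mid[P_{\mathsf{GF}}\,\underline{\mathsf U}\,P_{\mathsf F}], & P_{\mathsf{FG}}&::= P_{\mathsf{Prefix}}\mid\neg P_{\mathsf{GF}}\mid[P_{\mathsf{FG}}\,\underline{\mathsf U}\,P_{\mathsf{FG}}]\mid[P_{\mathsf G}\,\mathsf U\,P_{\mathsf{FG}}],\end{aligned}$$ where $v\in V$; $P_{\mathsf{Prefix}}::=P_{\mathsf G}\mid P_{\mathsf F}\mid\neg P_{\mathsf{Prefix}}\mid P_{\mathsf{Prefix}}\wedge P_{\mathsf{Prefix}}\mid P_{\mathsf{Prefix}}\vee P_{\mathsf{Prefix}}$; $P_{\mathsf{Assume}}::=P_{\mathsf{GF}}\mid P_{\mathsf{Assume}}\wedge P_{\mathsf{Assume}}$;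 $P_{\mathsf{Guarantee}}::=P_{\mathsf{GF}}\mid P_{\mathsf{Guarantee}}\wedge P_{\mathsf{Guarantee}}$; and $P_{\mathsf{GR(1)}}::=P_{\mathsf{Assume}}\to P_{\mathsf{Guarantee}}$. $\mathsf{TL}_{\mathsf{GF}}$ is the set of formulas derivable from $P_{\mathsf{GF}}$. **Automata.** An automaton over the alphabet $2^V$ is *initially equivalent* to $\varphi$ if it accepts exactly the infinite words on which $\varphi$ holds at position $0$. A *deterministic Büchi automaton* $(Q,q_0,\delta,p)$ has a finite state set $Q$, an initial state $q_0$, a transition function $\delta:Q\times 2^V\to Q$ and a set $p\subseteq Q$; it accepts a word iff its run on it visits $p$ infinitely often. The *GR(1)-automaton* of deterministic Büchi automata $\mathcal A^a_1,\dots,\mathcal A^a_n$ and $\mathcal A^g_1,\dots,\mathcal A^g_m$ with acceptance sets $p_1,\dots,p_n$ and $q_1,\dots,q_m$ is their product automaton (product state space, componentwise transitions, tuple of the initial states) that accepts a word iff the following holds for its run: if for every $i$ the $i$-th assumption component visits $p_i$ infinitely often, then for every $j$ the $j$-th guarantee component visits $q_j$ infinitely often. **Statement.** There is an algorithm that takes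 as input the number of variables and a formula over a finite set of numbered variables (as a word) and outputs a deterministic Büchi automaton (as a finite table), such that the following holds. Let $V$ be a finite set of numbered Boolean variables, and let $\Phi=(\varphi_1\wedge\dots\wedge\varphi_n)\to(\psi_1\wedge\dots\wedge\psi_m)$ with $n,m\ge 1$ (and any bracketing of the conjunctions) be a formula over $V$ that can be derived from $P_{\mathsf{GR(1)}}$. Then all $\varphi_i$ and $\psi_j$ belong to $\mathsf{TL}_{\mathsf{GF}}$; the automaton $\mathcal A^a_i$ computed from $\varphi_i$ is initially equivalent to $\varphi_i$ for each $i$, and the automaton $\mathcal A^g_j$ computed from $\psi_j$ is initially equivalent to $\psi_j$ for each $j$; and the GR(1)-automaton of $\mathcal A^a_1,\dots,\mathcal A^a_n$ and $\mathcal A^g_1,\dots,\mathcal A^g_m$ is initially equivalent to $\Phi$. -/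

import Mathlib

namespace GR1Fragment

/-! ### Linear temporal logic with past -/

/-- LTL formulas over a set `V` of Boolean variables.
In the binary temporal operators the second argument is the awaited event:
`sUntil φ ψ` is the strong until `[φ U ψ]`, `wBefore φ ψ` the weak before `[φ B ψ]`,
and `pSUntil`, `pBefore` are their past versions.
`wPrev` and `sPrev` are the weak and the strong previous operator. -/
inductive LTL (V : Type*) where
  | tru : LTL V
  | fls : LTL V
  | var (v : V) : LTL V
  | neg (φ : LTL V) : LTL V
  | conj (φ ψ : LTL V) : LTL V
  | disj (φ ψ : LTL V) : LTL V
  | nxt (φ : LTL V) : LTL V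
  | sUntil (φ ψ : LTL V) : LTL V
  | wBefore (φ ψ : LTL V) : LTL V
  | wPrev (φ : LTL V) : LTL V
  | sPrev (φ : LTL V) : LTL V
  | pSUntil (φ ψ : LTL V) : LTL V
  | pBefore (φ ψ : LTL V) : LTL V

namespace LTL

variable {V : Type*}

/-- `sat π t φ`: the formula `φ` holds on the path `π` (an infinite word over `2^V`)
at position `t`. -/
def sat (π : ℕ → Set V) : ℕ → LTL V → Prop
  | _, tru => True
  | _, fls => False
  | t, var v => v ∈ π t
  | t, neg φ => ¬ sat π t φ
  | t, conj φ ψ => sat π t φ ∧ sat π t ψ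
  | t, disj φ ψ => sat π t φ ∨ sat π t ψ
  | t, nxt φ => sat π (t + 1) φ
  | t, sUntil φ ψ => ∃ d, t ≤ d ∧ sat π d ψ ∧ ∀ s, t ≤ s → s < d → sat π s φ
  | t, wBefore φ ψ => ∀ d, t ≤ d → sat π d ψ → ∃ s, t ≤ s ∧ s < d ∧ sat π s φ
  | t, wPrev φ => t = 0 ∨ sat π (t - 1) φ
  | t, sPrev φ => 0 < t ∧ sat π (t - 1) φ
  | t, pSUntil φ ψ => ∃ d, d ≤ t ∧ sat π d ψ ∧ ∀ s, d < s → s ≤ t → sat π s φ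
  | t, pBefore φ ψ => ∀ d, d ≤ t → sat π d ψ → ∃ s, d < s ∧ s ≤ t ∧ sat π s φ

/-- Weak until `[φ U ψ]`, an abbreviation for `[ψ B (¬φ ∧ ¬ψ)]`. -/
def wUntil (φ ψ : LTL V) : LTL V := wBefore ψ (conj (neg φ) (neg ψ))

/-- Weak past until, an abbreviation in the same way. -/
def pUntil (φ ψ : LTL V) : LTL V := pBefore ψ (conj (neg φ) (neg ψ))

/-- Implication `φ → ψ`, an abbreviation for `¬φ ∨ ψ`. -/
def imp (φ ψ : LTL V) : LTL V := disj (neg φ) ψ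

/-- `IsConj [φ₁, …, φₙ] A`: the formula `A` is `φ₁ ∧ … ∧ φₙ`, bracketed in some way
(hence `n ≥ 1`). -/
inductive IsConj : List (LTL V) → LTL V → Prop
  | single (φ : LTL V) : IsConj [φ] φ
  | conj {l l' : List (LTL V)} {A B : LTL V} :
      IsConj l A → IsConj l' B → IsConj (l ++ l') (conj A B)

/-- The formula written as a word over `ℕ` in prefix (Polish) notation, where the variables
are numbered by `e`. Numbers below `12` are the constants and operators, and `12 + i` is the
variable with number `i`. This is the form in which a formula is given to an algorithm. -/
def toWord {k : ℕ} (e : V ≃ Fin k) : LTL V → List ℕ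
  | tru => [0]
  | fls => [1]
  | neg φ => 2 :: toWord e φ
  | conj φ ψ => 3 :: (toWord e φ ++ toWord e ψ)
  | disj φ ψ => 4 :: (toWord e φ ++ toWord e ψ)
  | nxt φ => 5 :: toWord e φ
  | sUntil φ ψ => 6 :: (toWord e φ ++ toWord e ψ)
  | wBefore φ ψ => 7 :: (toWord e φ ++ toWord e ψ)
  | wPrev φ => 8 :: toWord e φ
  | sPrev φ => 9 :: toWord e φ
  | pSUntil φ ψ => 10 :: (toWord e φ ++ toWord e ψ)
  | pBefore φ ψ => 11 :: (toWord e φ ++ toWord e ψ)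
  | var v => [12 + (e v : ℕ)]

end LTL

/-! ### The grammar of the fragment -/

/-- The nonterminals `P_G`, `P_F`, `P_Prefix`, `P_GF`, `P_FG`, `P_Assume`, `P_Guarantee`
and `P_GR(1)`. -/
inductive Nonterminal where
  | G | F | Prefix | GF | FG | Assume | Guarantee | GR1

open LTL Nonterminal in
/-- `Derives P φ`: the formula `φ` can be derived from the nonterminal `P`.
One constructor for each production of the grammar. -/
inductive Derives {V : Type*} : Nonterminal → LTL V → Prop
  -- safety
  | G_var (v : V) : Derives G (var v)
  | G_neg {φ} : Derives F φ → Derives G (neg φ)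
  | G_conj {φ ψ} : Derives G φ → Derives G ψ → Derives G (conj φ ψ)
  | G_disj {φ ψ} : Derives G φ → Derives G ψ → Derives G (disj φ ψ)
  | G_wPrev {φ} : Derives G φ → Derives G (wPrev φ)
  | G_pUntil {φ ψ} : Derives G φ → Derives G ψ → Derives G (pUntil φ ψ)
  | G_sPrev {φ} : Derives G φ → Derives G (sPrev φ)
  | G_pSUntil {φ ψ} : Derives G φ → Derives G ψ → Derives G (pSUntil φ ψ)
  | G_nxt {φ} : Derives G φ → Derives G (nxt φ)
  | G_wUntil {φ ψ} : Derives G φ → Derives G ψ → Derives G (wUntil φ ψ)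
  -- liveness
  | F_var (v : V) : Derives F (var v)
  | F_neg {φ} : Derives G φ → Derives F (neg φ)
  | F_conj {φ ψ} : Derives F φ → Derives F ψ → Derives F (conj φ ψ)
  | F_disj {φ ψ} : Derives F φ → Derives F ψ → Derives F (disj φ ψ)
  | F_wPrev {φ} : Derives F φ → Derives F (wPrev φ)
  | F_pUntil {φ ψ} : Derives F φ → Derives F ψ → Derives F (pUntil φ ψ)
  | F_sPrev {φ} : Derives F φ → Derives F (sPrev φ)
  | F_pSUntil {φ ψ} : Derives F φ → Derives F ψ → Derives F (pSUntil φ ψ)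
  | F_nxt {φ} : Derives F φ → Derives F (nxt φ)
  | F_sUntil {φ ψ} : Derives F φ → Derives F ψ → Derives F (sUntil φ ψ)
  -- prefix (obligation)
  | Prefix_G {φ} : Derives G φ → Derives Prefix φ
  | Prefix_F {φ} : Derives F φ → Derives Prefix φ
  | Prefix_neg {φ} : Derives Prefix φ → Derives Prefix (neg φ)
  | Prefix_conj {φ ψ} : Derives Prefix φ → Derives Prefix ψ → Derives Prefix (conj φ ψ)
  | Prefix_disj {φ ψ} : Derives Prefix φ → Derives Prefix ψ → Derives Prefix (disj φ ψ)
  -- fairness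
  | GF_prefix {φ} : Derives Prefix φ → Derives GF φ
  | GF_neg {φ} : Derives FG φ → Derives GF (neg φ)
  | GF_conj {φ ψ} : Derives GF φ → Derives GF ψ → Derives GF (conj φ ψ)
  | GF_disj {φ ψ} : Derives GF φ → Derives GF ψ → Derives GF (disj φ ψ)
  | GF_wPrev {φ} : Derives GF φ → Derives GF (wPrev φ)
  | GF_sPrev {φ} : Derives GF φ → Derives GF (sPrev φ)
  | GF_nxt {φ} : Derives GF φ → Derives GF (nxt φ)
  | GF_pUntil {φ ψ} : Derives GF φ → Derives GF ψ → Derives GF (pUntil φ ψ)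
  | GF_pSUntil {φ ψ} : Derives GF φ → Derives GF ψ → Derives GF (pSUntil φ ψ)
  | GF_wUntil {φ ψ} : Derives GF φ → Derives GF ψ → Derives GF (wUntil φ ψ)
  | GF_sUntil {φ ψ} : Derives GF φ → Derives F ψ → Derives GF (sUntil φ ψ)
  -- persistence
  | FG_prefix {φ} : Derives Prefix φ → Derives FG φ
  | FG_neg {φ} : Derives GF φ → Derives FG (neg φ)
  | FG_conj {φ ψ} : Derives FG φ → Derives FG ψ → Derives FG (conj φ ψ)
  | FG_disj {φ ψ} : Derives FG φ → Derives FG ψ → Derives FG (disj φ ψ)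
  | FG_wPrev {φ} : Derives FG φ → Derives FG (wPrev φ)
  | FG_nxt {φ} : Derives FG φ → Derives FG (nxt φ)
  | FG_sPrev {φ} : Derives FG φ → Derives FG (sPrev φ)
  | FG_pUntil {φ ψ} : Derives FG φ → Derives FG ψ → Derives FG (pUntil φ ψ)
  | FG_pSUntil {φ ψ} : Derives FG φ → Derives FG ψ → Derives FG (pSUntil φ ψ)
  | FG_sUntil {φ ψ} : Derives FG φ → Derives FG ψ → Derives FG (sUntil φ ψ)
  | FG_wUntil {φ ψ} : Derives G φ → Derives FG ψ → Derives FG (wUntil φ ψ)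
  -- assumptions, guarantees, and the GR(1) fragment
  | Assume_GF {φ} : Derives GF φ → Derives Assume φ
  | Assume_conj {φ ψ} : Derives Assume φ → Derives Assume ψ → Derives Assume (conj φ ψ)
  | Guarantee_GF {φ} : Derives GF φ → Derives Guarantee φ
  | Guarantee_conj {φ ψ} :
      Derives Guarantee φ → Derives Guarantee ψ → Derives Guarantee (conj φ ψ)
  | GR1_imp {φ ψ} : Derives Assume φ → Derives Guarantee ψ → Derives GR1 (imp φ ψ)

/-! ### Automata on infinite words -/

/-- An `ω`-automaton with finite state set `Q` over the alphabet `A`. -/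
structure OmegaAutomaton (Q A : Type*) [Finite Q] where
  init : Set Q
  trans : Set (Q × A × Q)
  acceptance : (ℕ → Q) → Prop

namespace OmegaAutomaton

variable {Q A : Type*} [Finite Q]

/-- `β` is a run of the word `α`. -/
def IsRun (M : OmegaAutomaton Q A) (α : ℕ → A) (β : ℕ → Q) : Prop :=
  β 0 ∈ M.init ∧ ∀ i, (β i, α i, β (i + 1)) ∈ M.trans

/-- The automaton accepts `α`: some run of `α` is accepting. -/
def Accepts (M : OmegaAutomaton Q A) (α : ℕ → A) : Prop :=
  ∃ β, M.IsRun α β ∧ M.acceptance β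

/-- Exactly one initial state, and exactly one successor for each state and letter. -/
def IsDeterministic (M : OmegaAutomaton Q A) : Prop :=
  (∃! q, q ∈ M.init) ∧ ∀ q a, ∃! q', (q, a, q') ∈ M.trans

/-- The automaton with one initial state `q₀` and a transition function `δ`. -/
def ofFun (q₀ : Q) (δ : Q → A → Q) (acc : (ℕ → Q) → Prop) : OmegaAutomaton Q A where
  init := {q₀}
  trans := {x | x.2.2 = δ x.1 x.2.1}
  acceptance := acc

theorem isDeterministic_ofFun (q₀ : Q) (δ : Q → A → Q) (acc : (ℕ → Q) → Prop) :
    (ofFun q₀ δ acc).IsDeterministic :=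
  ⟨⟨q₀, rfl, fun _ h => h⟩, fun q a => ⟨δ q a, rfl, fun _ h => h⟩⟩

/-- The automaton accepts exactly the paths on which `φ` holds at position `0`. -/
def InitiallyEquivalent {V : Type*} (M : OmegaAutomaton Q (Set V)) (φ : LTL V) : Prop :=
  ∀ α : ℕ → Set V, M.Accepts α ↔ LTL.sat α 0 φ

end OmegaAutomaton

/-- The run `β` visits the set `p` infinitely often. -/
def InfOften {Q : Type*} (p : Set Q) (β : ℕ → Q) : Prop := ∀ i, ∃ j, i ≤ j ∧ β j ∈ p

/-- A deterministic Büchi automaton `(Q, A, start, step, GF acc)`. -/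
structure DetBuchi (Q A : Type*) [Finite Q] where
  start : Q
  step : Q → A → Q
  acc : Set Q

/-- A deterministic Büchi automaton as an `ω`-automaton. -/
def DetBuchi.toOmega {Q A : Type*} [Finite Q] (M : DetBuchi Q A) : OmegaAutomaton Q A :=
  OmegaAutomaton.ofFun M.start M.step (InfOften M.acc)

/-- The GR(1)-automaton of deterministic Büchi automata `Ma i` for the assumptions and `Mg j`
for the guarantees: their product, with acceptance condition
`(⋀ i, GF pᵢ) → (⋀ j, GF qⱼ)`, where `pᵢ` and `qⱼ` are their Büchi sets. -/
def gr1Automaton {A : Type*} {n m : ℕ} {Qa : Fin n → Type*} {Qg : Fin m → Type*}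
    [∀ i, Finite (Qa i)] [∀ j, Finite (Qg j)]
    (Ma : ∀ i, DetBuchi (Qa i) A) (Mg : ∀ j, DetBuchi (Qg j) A) :
    OmegaAutomaton ((∀ i, Qa i) × (∀ j, Qg j)) A :=
  OmegaAutomaton.ofFun
    (fun i => (Ma i).start, fun j => (Mg j).start)
    (fun q a => (fun i => (Ma i).step (q.1 i) a, fun j => (Mg j).step (q.2 j) a))
    (fun β => (∀ i, InfOften (Ma i).acc (fun t => (β t).1 i)) →
      ∀ j, InfOften (Mg j).acc (fun t => (β t).2 j))

/-! ### Deterministic Büchi automata as finite data -/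

/-- Explicit finite description of a deterministic Büchi automaton:
`(N, start, table, acc)` describes an automaton with the states `0, …, N`, initial state
`start`, the transition table `table` (row = state, column = number of the letter) and the
list `acc` of accepting states. -/
abbrev BuchiTable : Type := ℕ × ℕ × List (List ℕ) × List ℕ

open Classical in
/-- The number in `{0, …, 2^k - 1}` of a letter `a ⊆ V`, i.e. of its characteristic bit vector,
where the variables are numbered by `e`. -/
noncomputable def letterIndex {V : Type*} {k : ℕ} (e : V ≃ Fin k) (a : Set V) : ℕ :=
  ∑ i : Fin k, if e.symm i ∈ a then 2 ^ (i : ℕ) else 0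

/-- The deterministic Büchi automaton over the alphabet `2^V` described by a table. A missing
entry is read as `0`, and an entry is reduced modulo the number of states (so that
every table describes some automaton, and every automaton with the states `0, …, N` has one). -/
noncomputable def BuchiTable.toDetBuchi {V : Type*} {k : ℕ} (e : V ≃ Fin k) (T : BuchiTable) :
    DetBuchi (Fin (T.1 + 1)) (Set V) where
  start := Fin.ofNat (T.1 + 1) T.2.1
  step q a := Fin.ofNat (T.1 + 1) ((T.2.2.1.getD q []).getD (letterIndex e a) 0)
  acc := {q | (q : ℕ) ∈ T.2.2.2}

end GR1Fragment

namespace GR1Fragment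

section

/-! ### Signed semantics with bounded eventualities -/

/-! The core is a deterministic Büchi automaton for each formula of the class `GF`; the conditional
acceptance condition then follows by taking the product.

Work with the complement. Give every formula a sign and push negations to the variables, so that the
only eventualities left are positive strong untils and negated weak befores. Such an eventuality at
`t` may be required to be witnessed at `t` itself or at a position at most `N`. The grammar is
designed so that a false `GF`-formula is already false with some finite `N`
(`Derives.classBounded`). For safety formulas that are true and liveness formulas that are false, `N
= 0` works uniformly. This uniformity is what the mixed productions need, because there infinitely
many positions impose obligations on one argument.

A tableau guesses a labelling of subformula occurrences by signs and checks the one-step unrollings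
of the operators. A labelling that claims the root false and infinitely often has no postponed
eventuality is sound for every formula (`IsTableau.bsat`). Conversely, when a `GF`-formula is false,
labelling by truth with bound `N` gives a tableau with no postponed eventuality from `N` on
(`isTableau_truthLabelling`, `not_pending_truthLabelling`). Thus the negation is recognised by a
nondeterministic co-Büchi automaton, and the formula holds iff every tableau run has postponed
eventualities infinitely often. The breakpoint construction (`breakpoint`) turns this universal
Büchi condition into a deterministic one by means of König's lemma.

For the algorithm, subformulas are positions of the input word, and labellings and sets of
labellings are binary numbers. Every ingredient is then a bounded quantification or a finite sum, so
the table is primitive recursive in the word (`primrec_compileWord`). No parsing or membership test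
is needed, since any word yields some table. -/

/-- Conjunction for `true`, disjunction for `false`. -/
def conn : Bool → Prop → Prop → Prop
  | true, x, y => x ∧ y
  | false, x, y => x ∨ y

/-- Strong until for `true`, its dual for `false`. A witness of a strong until that lies in the
proper future has to be at most `B`. -/
def fut (B : ℕ∞) : Bool → (ℕ → Prop) → (ℕ → Prop) → ℕ → Prop
  | true, p, q, t => ∃ d, t ≤ d ∧ (d = t ∨ (d : ℕ∞) ≤ B) ∧ q d ∧ ∀ s, t ≤ s → s < d → p s
  | false, p, q, t => ∀ d, t ≤ d → q d ∨ ∃ s, t ≤ s ∧ s < d ∧ p s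

/-- Strong past until for `true`, its dual for `false`. -/
def past : Bool → (ℕ → Prop) → (ℕ → Prop) → ℕ → Prop
  | true, p, q, t => ∃ d, d ≤ t ∧ q d ∧ ∀ s, d < s → s ≤ t → p s
  | false, p, q, t => ∀ d, d ≤ t → q d ∨ ∃ s, d < s ∧ s ≤ t ∧ p s

/-- Strong previous for `true`, weak previous for `false`. -/
def prev : Bool → (ℕ → Prop) → ℕ → Prop
  | true, p, t => 0 < t ∧ p (t - 1)
  | false, p, t => t = 0 ∨ p (t - 1)

/-- `bsat B π φ b t`: the formula `φ` has the truth value `b` at position `t`, and this is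
witnessed by resolving all eventualities of the proper future up to position `B`. -/
def bsat {V : Type*} (B : ℕ∞) (π : ℕ → Set V) : LTL V → Bool → ℕ → Prop
  | .tru => fun b _ => b = true
  | .fls => fun b _ => b = false
  | .var v => fun b t => v ∈ π t ↔ b = true
  | .neg φ => fun b t => bsat B π φ (!b) t
  | .conj φ ψ => fun b t => conn b (bsat B π φ b t) (bsat B π ψ b t)
  | .disj φ ψ => fun b t => conn (!b) (bsat B π φ b t) (bsat B π ψ b t)
  | .nxt φ => fun b t => bsat B π φ b (t + 1)
  | .sUntil φ ψ => fun b => fut B b (bsat B π φ b) (bsat B π ψ b)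
  | .wBefore φ ψ => fun b => fut B (!b) (bsat B π φ b) (bsat B π ψ (!b))
  | .wPrev φ => fun b => prev (!b) (bsat B π φ b)
  | .sPrev φ => fun b => prev b (bsat B π φ b)
  | .pSUntil φ ψ => fun b => past b (bsat B π φ b) (bsat B π ψ b)
  | .pBefore φ ψ => fun b => past (!b) (bsat B π φ b) (bsat B π ψ (!b))

variable {V : Type*}

/-- Without a bound the two signs are complementary. For a finite bound both may fail, which is why
the sign is carried along instead of a negation. -/
theorem bsat_top (π : ℕ → Set V) (φ : LTL V) (t : ℕ) :
    (bsat ⊤ π φ true t ↔ LTL.sat π t φ) ∧ (bsat ⊤ π φ false t ↔ ¬ LTL.sat π t φ) := by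
  induction φ generalizing t <;>
    simp_all [bsat, LTL.sat, conn, fut, past, prev] <;> grind

/-- A family of predicates that grows with the bound. -/
def Mono (p : ℕ → ℕ → Prop) : Prop := ∀ N N' t, N ≤ N' → p N t → p N' t

theorem conn_mono {u : Bool} {x y x' y' : Prop} (hx : x → x') (hy : y → y') :
    conn u x y → conn u x' y' := by
  cases u <;> simp only [conn] <;> tauto

theorem prev_mono {u : Bool} {p p' : ℕ → Prop} (hp : ∀ t, p t → p' t) (t : ℕ) :
    prev u p t → prev u p' t := by
  cases u <;> simp only [prev]
  · exact Or.imp_right (hp _)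
  · exact And.imp_right (hp _)

theorem past_mono {u : Bool} {p p' q q' : ℕ → Prop} (hp : ∀ t, p t → p' t)
    (hq : ∀ t, q t → q' t) (t : ℕ) : past u p q t → past u p' q' t := by
  cases u <;> simp only [past] <;> grind

theorem fut_mono {B B' : ℕ∞} (hB : B ≤ B') {u : Bool} {p p' q q' : ℕ → Prop}
    (hp : ∀ t, p t → p' t) (hq : ∀ t, q t → q' t) (t : ℕ) : fut B u p q t → fut B' u p' q' t := by
  cases u <;> simp only [fut]
  · grind
  · rintro ⟨d, h1, h2, h3, h4⟩
    exact ⟨d, h1, h2.imp_right fun h => h.trans hB, hq _ h3, fun s hs hs' => hp _ (h4 s hs hs')⟩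

/-- Negation only flips the sign, so all signed subformulas occur positively and a larger bound can
only help. -/
theorem bsat_mono {B B' : ℕ∞} (hB : B ≤ B') (π : ℕ → Set V) (φ : LTL V) (b : Bool) (t : ℕ) :
    bsat B π φ b t → bsat B' π φ b t := by
  induction φ generalizing b t with
  | tru | fls | var => exact id
  | neg φ h => exact h _ _
  | conj φ ψ h h' | disj φ ψ h h' => exact conn_mono (h _ _) (h' _ _)
  | nxt φ h => exact h _ _
  | sUntil φ ψ h h' | wBefore φ ψ h h' => exact fut_mono hB (h _) (h' _) t
  | wPrev φ h | sPrev φ h => exact prev_mono (h _) t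
  | pSUntil φ ψ h h' | pBefore φ ψ h h' => exact past_mono (h _) (h' _) t

/-! ### Bounds for the classes of the grammar -/

/-- Sets of bounds that have a common upper bound for any two elements. -/
def MaxClosed (I : Set ℕ) : Prop := 0 ∈ I ∧ ∀ a ∈ I, ∀ b ∈ I, max a b ∈ I

/-- Where `P` holds, so does `p N` for some bound `N` in `I`. -/
def Approx (I : Set ℕ) (P : ℕ → Prop) (p : ℕ → ℕ → Prop) : Prop :=
  ∀ t, P t → ∃ N ∈ I, p N t

theorem maxClosed_zero : MaxClosed {0} := ⟨rfl, by simp⟩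

theorem maxClosed_univ : MaxClosed Set.univ := ⟨trivial, by simp⟩

/-- Only finitely many positions are concerned, so the maximum of their bounds serves for all of
them. -/
theorem exists_bound {I : Set ℕ} (hI : MaxClosed I) {p : ℕ → ℕ → Prop} (hp : Mono p) (d : ℕ)
    (S : Set ℕ) (h : ∀ s < d, s ∈ S → ∃ N ∈ I, p N s) : ∃ N ∈ I, ∀ s < d, s ∈ S → p N s := by
  induction d with
  | zero => exact ⟨0, hI.1, by simp⟩
  | succ d ih =>
    obtain ⟨N, hN, h1⟩ := ih fun s hs => h s (by omega)
    by_cases hd : d ∈ S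
    · obtain ⟨N', hN', h2⟩ := h d (by omega) hd
      refine ⟨max N N', hI.2 _ hN _ hN', fun s hs hS => ?_⟩
      rcases Nat.lt_succ_iff_lt_or_eq.1 hs with hs | rfl
      · exact hp _ _ _ (le_max_left _ _) (h1 s hs hS)
      · exact hp _ _ _ (le_max_right _ _) h2
    · refine ⟨N, hN, fun s hs hS => h1 s ?_ hS⟩
      rcases Nat.lt_succ_iff_lt_or_eq.1 hs with hs | rfl
      · exact hs
      · exact absurd hS hd

/-! ### Bounds for each operator from bounds for its arguments -/

section Approx
variable {I : Set ℕ} {P Q : ℕ → Prop} {p q : ℕ → ℕ → Prop}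

theorem Approx.conn (hI : MaxClosed I) (hp : Mono p) (hq : Mono q) (u : Bool)
    (h : Approx I P p) (h' : Approx I Q q) :
    Approx I (fun t => conn u (P t) (Q t)) (fun N t => conn u (p N t) (q N t)) := by
  intro t
  cases u
  · rintro (H | H)
    · obtain ⟨N, hN, H⟩ := h t H
      exact ⟨N, hN, Or.inl H⟩
    · obtain ⟨N, hN, H⟩ := h' t H
      exact ⟨N, hN, Or.inr H⟩
  · rintro ⟨H, H'⟩
    obtain ⟨N, hN, H⟩ := h t H
    obtain ⟨N', hN', H'⟩ := h' t H'
    exact ⟨_, hI.2 _ hN _ hN', hp _ _ _ (le_max_left _ _) H, hq _ _ _ (le_max_right _ _) H'⟩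

theorem Approx.prev (hI : MaxClosed I) (u : Bool) (h : Approx I P p) :
    Approx I (prev u P) (fun N => prev u (p N)) := by
  intro t
  cases u
  · rintro (rfl | H)
    · exact ⟨0, hI.1, Or.inl rfl⟩
    · obtain ⟨N, hN, H⟩ := h _ H
      exact ⟨N, hN, Or.inr H⟩
  · rintro ⟨ht, H⟩
    obtain ⟨N, hN, H⟩ := h _ H
    exact ⟨N, hN, ht, H⟩

theorem Approx.next (h : Approx I P p) :
    Approx I (fun t => P (t + 1)) (fun N t => p N (t + 1)) := fun t => h (t + 1)

/-- A past operator inspects only the positions up to `t`, so either sign needs finitely many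
bounds. This is why all classes are closed under the past operators. -/
theorem Approx.past (hI : MaxClosed I) (hp : Mono p) (hq : Mono q) (u : Bool)
    (h : Approx I P p) (h' : Approx I Q q) :
    Approx I (past u P Q) (fun N => past u (p N) (q N)) := by
  intro t
  cases u
  · intro H
    obtain ⟨N, hN, h1⟩ := exists_bound hI hp (t + 1) {s | P s} fun s _ hs => h s hs
    obtain ⟨N', hN', h2⟩ := exists_bound hI hq (t + 1) {s | Q s} fun s _ hs => h' s hs
    refine ⟨_, hI.2 _ hN _ hN', fun d hd => ?_⟩
    rcases H d hd with H | ⟨s, hs, hs', H⟩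
    · exact Or.inl (hq _ _ _ (le_max_right _ _) (h2 d (by omega) H))
    · exact Or.inr ⟨s, hs, hs', hp _ _ _ (le_max_left _ _) (h1 s (by omega) H)⟩
  · rintro ⟨d, hd, H, H'⟩
    obtain ⟨N, hN, h1⟩ := exists_bound hI hp (t + 1) {s | d < s} fun s hs hs' =>
      h s (H' s hs' (by omega))
    obtain ⟨N', hN', h2⟩ := h' d H
    exact ⟨_, hI.2 _ hN _ hN', d, hd, hq _ _ _ (le_max_right _ _) h2, fun s hs hs' =>
      hp _ _ _ (le_max_left _ _) (h1 s (by omega) hs)⟩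

theorem Approx.fut_true (hp : Mono p) (hq : Mono q) (h : Approx Set.univ P p)
    (h' : Approx Set.univ Q q) :
    Approx Set.univ (fut ⊤ true P Q) (fun N => fut N true (p N) (q N)) := by
  rintro t ⟨d, hd, -, H, H'⟩
  obtain ⟨N, -, h1⟩ := exists_bound maxClosed_univ hp d {s | t ≤ s} fun s hs hs' =>
    h s (H' s hs' hs)
  obtain ⟨N', -, h2⟩ := h' d H
  -- The bound must exceed the witness `d` too, so even arguments with bound `0` give no uniform
  -- bound here.
  refine ⟨max d (max N N'), trivial, d, hd, Or.inr (by simp), ?_, fun s hs hs' => ?_⟩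
  · exact hq _ _ _ (by simp) h2
  · exact hp _ _ _ (by simp) (h1 s hs' hs)

theorem Approx.fut_false_zero (h : Approx {0} P p) (h' : Approx {0} Q q) :
    Approx {0} (fut ⊤ false P Q) (fun N => fut N false (p N) (q N)) := by
  simp only [Approx, Set.mem_singleton_iff, exists_eq_left] at *
  exact fun t H d hd => (H d hd).imp (h' d) fun ⟨s, hs, hs', H⟩ => ⟨s, hs, hs', h s H⟩

/-- The second argument may be required at infinitely many positions and therefore needs the uniform
bound `0`. The first is needed only at its earliest occurrence, which discharges all later
positions, so one bound for that occurrence suffices. -/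
theorem Approx.fut_false (hq : Mono q) (h : Approx Set.univ P p) (h' : Approx {0} Q q) :
    Approx Set.univ (fut ⊤ false P Q) (fun N => fut N false (p N) (q N)) := by
  classical
  simp only [Approx, Set.mem_singleton_iff, exists_eq_left] at h'
  intro t H
  by_cases hs : ∃ s, t ≤ s ∧ P s
  · obtain ⟨hs1, hs2⟩ := Nat.find_spec hs
    obtain ⟨N, -, hN⟩ := h _ hs2
    refine ⟨N, trivial, fun d hd => ?_⟩
    by_cases hd' : Nat.find hs < d
    · exact Or.inr ⟨_, hs1, hd', hN⟩
    · refine Or.inl (hq 0 N d (Nat.zero_le _) (h' d ((H d hd).resolve_right ?_)))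
      rintro ⟨s, h1, h2, h3⟩
      exact Nat.find_min hs (by omega) ⟨h1, h3⟩
  · refine ⟨0, trivial, fun d hd => Or.inl (h' d ((H d hd).resolve_right ?_))⟩
    rintro ⟨s, h1, -, h3⟩
    exact hs ⟨s, h1, h3⟩

theorem Approx.mono {J : Set ℕ} (hIJ : I ⊆ J) (h : Approx I P p) : Approx J P p := fun t ht =>
  let ⟨N, hN, H⟩ := h t ht
  ⟨N, hIJ hN, H⟩

/-- In a weak until, the awaited event also occurs in the second argument of the underlying weak
before, so `Approx.fut_false` does not apply. Splitting at the first occurrence of `Q` repairs this: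
before it only `P` is used, with bound `0`, and from it on the single bound for that occurrence is
enough. -/
theorem Approx.fut_false_wUntil (hp : Mono p)
    (h : Approx {0} P p) (h' : Approx Set.univ Q q) :
    Approx Set.univ (fut ⊤ false Q (fun t => P t ∨ Q t))
      (fun N => fut N false (q N) (fun t => p N t ∨ q N t)) := by
  classical
  simp only [Approx, Set.mem_singleton_iff, exists_eq_left] at h
  intro t H
  by_cases hs : ∃ s, t ≤ s ∧ Q s
  · obtain ⟨hs1, hs2⟩ := Nat.find_spec hs
    obtain ⟨N, -, hN⟩ := h' _ hs2
    refine ⟨N, trivial, fun d hd => ?_⟩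
    rcases lt_trichotomy (Nat.find hs) d with hd' | hd' | hd'
    · exact Or.inr ⟨_, hs1, hd', hN⟩
    · exact Or.inl (Or.inr (hd' ▸ hN))
    · have hQ := fun s (hs' : t ≤ s ∧ s ≤ d) (hQ : Q s) =>
        Nat.find_min hs (show s < _ by omega) ⟨hs'.1, hQ⟩
      refine Or.inl (Or.inl (hp 0 N d (Nat.zero_le _) (h d ?_)))
      rcases H d hd with (H | H) | ⟨s, h1, h2, h3⟩
      · exact H
      · exact absurd H (hQ d ⟨hd, le_rfl⟩)
      · exact absurd h3 (hQ s ⟨h1, h2.le⟩)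
  · refine ⟨0, trivial, fun d hd => Or.inl (Or.inl (h d ?_))⟩
    rcases H d hd with (H | H) | ⟨s, h1, h2, h3⟩
    · exact H
    · exact absurd ⟨d, hd, H⟩ hs
    · exact absurd ⟨s, h1, h3⟩ hs

end Approx

/-- If `φ` has the truth value `b`, this is witnessed with a bound in `I`. -/
def Bounded (I : Set ℕ) (π : ℕ → Set V) (b : Bool) (φ : LTL V) : Prop :=
  Approx I (bsat ⊤ π φ b) (fun N => bsat N π φ b)

theorem mono_bsat (π : ℕ → Set V) (φ : LTL V) (b : Bool) : Mono (fun N => bsat N π φ b) :=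
  fun _ _ t h => bsat_mono (by exact_mod_cast h) π φ b t

/-- What the grammar guarantees about the formulas of each temporal class. -/
def ClassBounded (π : ℕ → Set V) : Nonterminal → LTL V → Prop
  | .G, φ => Bounded {0} π true φ ∧ Bounded Set.univ π false φ
  | .F, φ => Bounded Set.univ π true φ ∧ Bounded {0} π false φ
  | .Prefix, φ => Bounded Set.univ π true φ ∧ Bounded Set.univ π false φ
  | .GF, φ => Bounded Set.univ π false φ
  | .FG, φ => Bounded Set.univ π true φ
  | _, _ => True

section Bounded
variable {I : Set ℕ} {π : ℕ → Set V} {b : Bool} {φ ψ : LTL V}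

theorem Bounded.var (hI : MaxClosed I) (v : V) : Bounded I π b (.var v) :=
  fun _ h => ⟨0, hI.1, h⟩

theorem Bounded.neg (h : Bounded I π (!b) φ) : Bounded I π b (.neg φ) := h

theorem Bounded.conj (hI : MaxClosed I) (h : Bounded I π b φ) (h' : Bounded I π b ψ) :
    Bounded I π b (.conj φ ψ) := Approx.conn hI (mono_bsat _ _ _) (mono_bsat _ _ _) _ h h'

theorem Bounded.disj (hI : MaxClosed I) (h : Bounded I π b φ) (h' : Bounded I π b ψ) :
    Bounded I π b (.disj φ ψ) := Approx.conn hI (mono_bsat _ _ _) (mono_bsat _ _ _) _ h h'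

theorem Bounded.nxt (h : Bounded I π b φ) : Bounded I π b (.nxt φ) := Approx.next h

theorem Bounded.wPrev (hI : MaxClosed I) (h : Bounded I π b φ) : Bounded I π b (.wPrev φ) :=
  Approx.prev hI _ h

theorem Bounded.sPrev (hI : MaxClosed I) (h : Bounded I π b φ) : Bounded I π b (.sPrev φ) :=
  Approx.prev hI _ h

theorem Bounded.pSUntil (hI : MaxClosed I) (h : Bounded I π b φ) (h' : Bounded I π b ψ) :
    Bounded I π b (.pSUntil φ ψ) := Approx.past hI (mono_bsat _ _ _) (mono_bsat _ _ _) _ h h'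

theorem Bounded.neither (hI : MaxClosed I) (h : Bounded I π b φ) (h' : Bounded I π b ψ) :
    Bounded I π (!b) (.conj (.neg φ) (.neg ψ)) :=
  Bounded.conj hI (Bounded.neg (by simpa using h)) (Bounded.neg (by simpa using h'))

theorem Bounded.pUntil (hI : MaxClosed I) (h : Bounded I π b φ) (h' : Bounded I π b ψ) :
    Bounded I π b (.pUntil φ ψ) :=
  Approx.past hI (mono_bsat _ _ _) (mono_bsat _ _ _) _ h' (Bounded.neither hI h h')

theorem Bounded.sUntil_true (h : Bounded Set.univ π true φ) (h' : Bounded Set.univ π true ψ) :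
    Bounded Set.univ π true (.sUntil φ ψ) :=
  Approx.fut_true (mono_bsat _ _ _) (mono_bsat _ _ _) h h'

theorem Bounded.sUntil_false_zero (h : Bounded {0} π false φ) (h' : Bounded {0} π false ψ) :
    Bounded {0} π false (.sUntil φ ψ) := Approx.fut_false_zero h h'

theorem Bounded.sUntil_false (h : Bounded Set.univ π false φ) (h' : Bounded {0} π false ψ) :
    Bounded Set.univ π false (.sUntil φ ψ) := Approx.fut_false (mono_bsat _ _ _) h h'

theorem Bounded.wUntil_false (h : Bounded Set.univ π false φ)
    (h' : Bounded Set.univ π false ψ) : Bounded Set.univ π false (.wUntil φ ψ) :=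
  Approx.fut_true (mono_bsat _ _ _) (mono_bsat _ _ _) h' (Bounded.neither maxClosed_univ h h')

theorem Bounded.wUntil_true_zero (h : Bounded {0} π true φ) (h' : Bounded {0} π true ψ) :
    Bounded {0} π true (.wUntil φ ψ) :=
  Approx.fut_false_zero h' (Bounded.neither maxClosed_zero h h')

theorem Bounded.wUntil_true (h : Bounded {0} π true φ) (h' : Bounded Set.univ π true ψ) :
    Bounded Set.univ π true (.wUntil φ ψ) :=
  Approx.fut_false_wUntil (mono_bsat _ _ _) h h'

theorem Bounded.of_zero (h : Bounded {0} π b φ) : Bounded Set.univ π b φ :=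
  Approx.mono (Set.subset_univ _) h

end Bounded

/-- Each production matches one closure property of bounds. The asymmetric ones, a `GF` until with
an `F` event and a weak until of `G` and `FG`, are exactly those where one argument must have bound
`0`. -/
theorem Derives.classBounded (π : ℕ → Set V) {P : Nonterminal} {φ : LTL V} (h : Derives P φ) :
    ClassBounded π P φ := by
  have h0 := maxClosed_zero
  have hu := maxClosed_univ
  induction h with
  | G_var v | F_var v => exact ⟨.var ‹_› v, .var ‹_› v⟩
  | G_neg _ h | F_neg _ h | Prefix_neg _ h => exact ⟨.neg h.2, .neg h.1⟩
  | G_conj _ _ h h' | F_conj _ _ h h' | Prefix_conj _ _ h h' =>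
    exact ⟨.conj ‹_› h.1 h'.1, .conj ‹_› h.2 h'.2⟩
  | G_disj _ _ h h' | F_disj _ _ h h' | Prefix_disj _ _ h h' =>
    exact ⟨.disj ‹_› h.1 h'.1, .disj ‹_› h.2 h'.2⟩
  | G_wPrev _ h | F_wPrev _ h => exact ⟨.wPrev ‹_› h.1, .wPrev ‹_› h.2⟩
  | G_sPrev _ h | F_sPrev _ h => exact ⟨.sPrev ‹_› h.1, .sPrev ‹_› h.2⟩
  | G_pUntil _ _ h h' | F_pUntil _ _ h h' => exact ⟨.pUntil ‹_› h.1 h'.1, .pUntil ‹_› h.2 h'.2⟩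
  | G_pSUntil _ _ h h' | F_pSUntil _ _ h h' =>
    exact ⟨.pSUntil ‹_› h.1 h'.1, .pSUntil ‹_› h.2 h'.2⟩
  | G_nxt _ h | F_nxt _ h => exact ⟨.nxt h.1, .nxt h.2⟩
  | G_wUntil _ _ h h' => exact ⟨.wUntil_true_zero h.1 h'.1, .wUntil_false h.2 h'.2⟩
  | F_sUntil _ _ h h' => exact ⟨.sUntil_true h.1 h'.1, .sUntil_false_zero h.2 h'.2⟩
  | Prefix_G _ h => exact ⟨.of_zero h.1, h.2⟩
  | Prefix_F _ h => exact ⟨h.1, .of_zero h.2⟩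
  | GF_prefix _ h => exact h.2
  | FG_prefix _ h => exact h.1
  | GF_neg _ h | FG_neg _ h => exact Bounded.neg h
  | GF_conj _ _ h h' | FG_conj _ _ h h' => exact Bounded.conj hu h h'
  | GF_disj _ _ h h' | FG_disj _ _ h h' => exact Bounded.disj hu h h'
  | GF_wPrev _ h | FG_wPrev _ h => exact Bounded.wPrev hu h
  | GF_sPrev _ h | FG_sPrev _ h => exact Bounded.sPrev hu h
  | GF_nxt _ h | FG_nxt _ h => exact Bounded.nxt h
  | GF_pUntil _ _ h h' | FG_pUntil _ _ h h' => exact Bounded.pUntil hu h h'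
  | GF_pSUntil _ _ h h' | FG_pSUntil _ _ h h' => exact Bounded.pSUntil hu h h'
  | GF_wUntil _ _ h h' => exact Bounded.wUntil_false h h'
  | GF_sUntil _ _ h h' => exact Bounded.sUntil_false h h'.2
  | FG_sUntil _ _ h h' => exact Bounded.sUntil_true h h'
  | FG_wUntil _ _ h h' => exact Bounded.wUntil_true h.1 h'
  | Assume_GF | Assume_conj | Guarantee_GF | Guarantee_conj | GR1_imp => trivial

end

section

/-! ### Subformulas as positions of a word -/

/-- The lengths of the formulas that start at the positions of a word in prefix notation. -/
def formulaLengths (w : List ℕ) : List ℕ :=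
  w.foldr (fun c ls =>
    (if c < 2 ∨ 12 ≤ c then 1
      else if c = 2 ∨ c = 5 ∨ c = 8 ∨ c = 9 then 1 + ls.getD 0 0
      else 1 + ls.getD 0 0 + ls.getD (ls.getD 0 0) 0) :: ls) []

/-- The position of the second argument of the binary operator at position `i`. -/
def secondArg (w : List ℕ) (i : ℕ) : ℕ := i + 1 + (formulaLengths w).getD (i + 1) 0

variable {V : Type*} {k : ℕ} {e : V ≃ Fin k}

theorem drop_formulaLengths (w : List ℕ) (i : ℕ) :
    (formulaLengths w).drop i = formulaLengths (w.drop i) := by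
  induction w generalizing i with
  | nil => simp [formulaLengths]
  | cons c w ih => cases i with
    | zero => rfl
    | succ i => exact ih i

theorem getD_drop_zero {α : Type*} (l : List α) (i : ℕ) (d : α) :
    (l.drop i).getD 0 d = l.getD i d := by simp [List.getD]

/-- Lengths are computed from the right, so the length of the first argument is at the head of the
list and locates that of the second. The suffix `r` is irrelevant because prefix notation delimits
itself. -/
theorem formulaLengths_toWord (φ : LTL V) (r : List ℕ) :
    (formulaLengths (φ.toWord e ++ r)).getD 0 0 = (φ.toWord e).length := by
  have key (u : List ℕ) (ψ : LTL V) (r : List ℕ)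
      (h : ∀ r, (formulaLengths (ψ.toWord e ++ r)).getD 0 0 = (ψ.toWord e).length) :
      (formulaLengths (u ++ (ψ.toWord e ++ r))).getD u.length 0 = (ψ.toWord e).length := by
    rw [← getD_drop_zero, drop_formulaLengths, List.drop_left, h]
  have two (c : ℕ) (φ ψ : LTL V) (hc : 2 < c ∧ c < 12 ∧ c ≠ 5 ∧ c ≠ 8 ∧ c ≠ 9)
      (h : ∀ r, (formulaLengths (φ.toWord e ++ r)).getD 0 0 = (φ.toWord e).length)
      (h' : ∀ r, (formulaLengths (ψ.toWord e ++ r)).getD 0 0 = (ψ.toWord e).length) (r : List ℕ) :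
      (formulaLengths (c :: (φ.toWord e ++ ψ.toWord e) ++ r)).getD 0 0 =
        (c :: (φ.toWord e ++ ψ.toWord e)).length := by
    have h1 := key (φ.toWord e) ψ r h'
    have h2 := h (ψ.toWord e ++ r)
    rw [List.cons_append, List.append_assoc, formulaLengths, List.foldr_cons, ← formulaLengths,
      List.getD_cons_zero, if_neg (by omega), if_neg (by omega), h2, h1, List.length_cons,
      List.length_append]
    omega
  have one (c : ℕ) (φ : LTL V) (hc : c = 2 ∨ c = 5 ∨ c = 8 ∨ c = 9)
      (h : ∀ r, (formulaLengths (φ.toWord e ++ r)).getD 0 0 = (φ.toWord e).length) (r : List ℕ) :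
      (formulaLengths (c :: φ.toWord e ++ r)).getD 0 0 = (c :: φ.toWord e).length := by
    rw [List.cons_append, formulaLengths, List.foldr_cons, ← formulaLengths,
      List.getD_cons_zero, if_neg (by omega), if_pos hc, h, List.length_cons, add_comm]
  induction φ generalizing r with
  | tru | fls => rfl
  | var v => simp [formulaLengths, LTL.toWord]
  | neg φ h | nxt φ h | wPrev φ h | sPrev φ h => exact one _ φ (by norm_num) h r
  | conj φ ψ h h' | disj φ ψ h h' | sUntil φ ψ h h' | wBefore φ ψ h h' | pSUntil φ ψ h h'
  | pBefore φ ψ h h' => exact two _ φ ψ (by norm_num) h h' r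

/-- The formula `φ` starts at position `i` of the word `w`. -/
def SubAt (e : V ≃ Fin k) (w : List ℕ) (i : ℕ) (φ : LTL V) : Prop :=
  ∃ r, w.drop i = φ.toWord e ++ r

section SubAt
variable {w r : List ℕ} {i c : ℕ} {φ ψ : LTL V}

theorem getD_of_drop (h : w.drop i = c :: r) : w.getD i 0 = c := by
  rw [← getD_drop_zero, h]; rfl

theorem drop_succ_of_drop (h : w.drop i = c :: r) : w.drop (i + 1) = r := by
  rw [← List.drop_drop, h]; rfl

theorem lt_of_drop (h : w.drop i = c :: r) : i < w.length := by
  by_contra hi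
  rw [List.drop_eq_nil_of_le (by omega)] at h
  simp at h

theorem subAt_of_drop (h : w.drop i = c :: (φ.toWord e ++ r)) : SubAt e w (i + 1) φ :=
  ⟨r, drop_succ_of_drop h⟩

theorem subAt_secondArg_of_drop (h : w.drop i = c :: (φ.toWord e ++ (ψ.toWord e ++ r))) :
    SubAt e w (secondArg w i) ψ := by
  refine ⟨r, ?_⟩
  have h1 := drop_succ_of_drop h
  rw [secondArg, ← getD_drop_zero, drop_formulaLengths, h1, formulaLengths_toWord,
    ← List.drop_drop, h1, List.drop_left]

theorem SubAt.lt_length (h : SubAt e w i φ) : i < w.length := by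
  obtain ⟨r, h⟩ := h
  cases φ <;> exact lt_of_drop h

end SubAt

/-! ### The tableau

A labelling `X : ℕ → Bool → Prop` marks positions of the word with truth values. -/

/-- One step of the fixpoint characterisation of an until (`true`) or its dual (`false`). -/
def unroll : Bool → Prop → Prop → Prop → Prop
  | true, x, y, z => y ∨ (x ∧ z)
  | false, x, y, z => y ∧ (x ∨ z)

/-- The constraints of the non-past operators on the present labelling `X` and the
next one `Y`, where `a` are the numbers of the variables that hold at present. -/
def NextOK (w : List ℕ) (a : ℕ → Prop) (X Y : ℕ → Bool → Prop) (i : ℕ) (b : Bool) : Prop :=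
  (w.getD i 0 = 0 → b = true) ∧
  (w.getD i 0 = 1 → b = false) ∧
  (w.getD i 0 = 2 → X (i + 1) (!b)) ∧
  (w.getD i 0 = 3 → conn b (X (i + 1) b) (X (secondArg w i) b)) ∧
  (w.getD i 0 = 4 → conn (!b) (X (i + 1) b) (X (secondArg w i) b)) ∧
  (w.getD i 0 = 5 → Y (i + 1) b) ∧
  (w.getD i 0 = 6 → unroll b (X (i + 1) b) (X (secondArg w i) b) (Y i b)) ∧
  (w.getD i 0 = 7 → unroll (!b) (X (i + 1) b) (X (secondArg w i) (!b)) (Y i b)) ∧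
  (12 ≤ w.getD i 0 → (a (w.getD i 0 - 12) ↔ b = true))

/-- The value `x` at the previous position, with the default `d` at the first one. -/
def before (first d x : Prop) : Prop := (first ∧ d) ∨ (¬ first ∧ x)

/-- The constraints of the past operators on the present labelling `X` and the previous one `Z`. -/
def PrevOK (w : List ℕ) (first : Prop) (X Z : ℕ → Bool → Prop) (i : ℕ) (b : Bool) : Prop :=
  (w.getD i 0 = 8 → before first (b = true) (Z (i + 1) b)) ∧
  (w.getD i 0 = 9 → before first (b = false) (Z (i + 1) b)) ∧
  (w.getD i 0 = 10 → unroll b (X (i + 1) b) (X (secondArg w i) b)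
    (before first (b = false) (Z i b))) ∧
  (w.getD i 0 = 11 → unroll (!b) (X (i + 1) b) (X (secondArg w i) (!b))
    (before first (b = true) (Z i b)))

/-- The eventuality at position `i` with the value `b` is postponed. -/
def PendingAt (w : List ℕ) (X : ℕ → Bool → Prop) (i : ℕ) (b : Bool) : Prop :=
  ((w.getD i 0 = 6 ∧ b = true) ∨ (w.getD i 0 = 7 ∧ b = false)) ∧
    X i b ∧ ¬ X (secondArg w i) true

/-- Some eventuality is postponed. -/
def Pending (w : List ℕ) (X : ℕ → Bool → Prop) : Prop :=
  ∃ i < w.length, ∃ b, PendingAt w X i b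

/-- A sequence of labellings meets the constraints along the sequence `a` of letters. -/
structure IsTableau (w : List ℕ) (a : ℕ → ℕ → Prop) (X : ℕ → ℕ → Bool → Prop) : Prop where
  next : ∀ t, ∀ i < w.length, ∀ b, X t i b → NextOK w (a t) (X t) (X (t + 1)) i b
  prev : ∀ t, ∀ i < w.length, ∀ b, X t i b → PrevOK w (t = 0) (X t) (X (t - 1)) i b

/-! ### Fixpoint laws of the until operators -/

theorem unroll_mono {u : Bool} {x y z x' y' z' : Prop} (hx : x → x') (hy : y → y') (hz : z → z') :
    unroll u x y z → unroll u x' y' z' := by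
  cases u <;> simp only [unroll] <;> tauto

/-- The converse fails for a finite bound: a witness at `t + 1` beyond `B` is allowed at `t + 1` but
not at `t`. -/
theorem fut_unroll {B : ℕ∞} {u : Bool} {p q : ℕ → Prop} {t : ℕ} (h : fut B u p q t) :
    unroll u (p t) (q t) (fut B u p q (t + 1)) := by
  cases u
  · refine ⟨(h t le_rfl).resolve_right (by rintro ⟨s, h1, h2, -⟩; omega), ?_⟩
    refine or_iff_not_imp_left.2 fun hp d hd => (h d (by omega)).imp_right ?_
    rintro ⟨s, h1, h2, h3⟩
    exact ⟨s, Nat.lt_of_le_of_ne h1 (by rintro rfl; exact hp h3), h2, h3⟩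
  · obtain ⟨d, h1, h2, h3, h4⟩ := h
    rcases h1.eq_or_lt with rfl | h1
    · exact Or.inl h3
    · exact Or.inr ⟨h4 t le_rfl h1, d, h1, Or.inr (h2.resolve_left (by omega)), h3,
        fun s hs hs' => h4 s (by omega) hs'⟩

/-- The dual of until is a greatest fixpoint, so consistency with the unrolling suffices. Until is a
least fixpoint and also needs `hu`, which forbids postponing forever. -/
theorem fut_of_unroll {u : Bool} {p q z : ℕ → Prop}
    (h : ∀ t, z t → unroll u (p t) (q t) (z (t + 1)))
    (hu : u = true → ∀ T, ∃ t, T ≤ t ∧ (z t → q t)) {t : ℕ} (ht : z t) : fut ⊤ u p q t := by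
  cases u
  · intro d hd
    refine or_iff_not_imp_right.2 fun hs => ?_
    suffices z d from (h d this).1
    induction d, hd using Nat.le_induction with
    | base => exact ht
    | succ d hd ih =>
      have := ih fun ⟨s, h1, h2, h3⟩ => hs ⟨s, h1, by omega, h3⟩
      exact (h d this).2.resolve_left fun hp => hs ⟨d, hd, by omega, hp⟩
  · obtain ⟨T, hT, hq⟩ := hu rfl t
    induction n : T - t generalizing t with
    | zero =>
      obtain rfl : T = t := by omega
      exact ⟨T, le_rfl, Or.inl rfl, hq ht, fun s _ _ => by omega⟩
    | succ n ih =>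
      rcases h t ht with h1 | ⟨h1, h2⟩
      · exact ⟨t, le_rfl, Or.inl rfl, h1, fun s _ _ => by omega⟩
      · obtain ⟨d, h3, -, h4, h5⟩ := ih h2 (by omega) (by omega)
        refine ⟨d, by omega, Or.inr le_top, h4, fun s hs hs' => ?_⟩
        rcases hs.eq_or_lt with rfl | hs
        · exact h1
        · exact h5 s hs hs'

theorem prev_iff_before {u : Bool} {p : ℕ → Prop} {t : ℕ} :
    prev u p t ↔ before (t = 0) (u = false) (p (t - 1)) := by
  cases u <;> simp only [prev, before] <;> grind

theorem past_iff_unroll {u : Bool} {p q : ℕ → Prop} {t : ℕ} : past u p q t ↔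
    unroll u (p t) (q t) (before (t = 0) (u = false) (past u p q (t - 1))) := by
  cases t with
  | zero =>
    cases u <;> simp [past, before, unroll]
    grind
  | succ t =>
    cases u
    · simp only [past, before, unroll, Nat.add_sub_cancel]
      constructor
      · intro h
        refine ⟨(h _ le_rfl).resolve_right (by rintro ⟨s, h1, h2, -⟩; omega), ?_⟩
        refine or_iff_not_imp_left.2 fun hp =>
          Or.inr ⟨by omega, fun d hd => (h d (by omega)).imp_right ?_⟩
        rintro ⟨s, h1, h2, h3⟩
        exact ⟨s, h1, Nat.le_of_lt_succ (Nat.lt_of_le_of_ne h2 (by rintro rfl; exact hp h3)), h3⟩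
      · rintro ⟨hq, h⟩ d hd
        rcases hd.eq_or_lt with rfl | hd
        · exact Or.inl hq
        · rcases h with h | h | h
          · exact Or.inr ⟨_, hd, le_rfl, h⟩
          · omega
          · exact (h.2 d (by omega)).imp_right fun ⟨s, h1, h2, h3⟩ => ⟨s, h1, by omega, h3⟩
    · simp only [past, before, unroll, Nat.add_sub_cancel]
      constructor
      · rintro ⟨d, h1, h2, h3⟩
        rcases h1.eq_or_lt with rfl | h1
        · exact Or.inl h2
        · exact Or.inr ⟨h3 _ h1 le_rfl, Or.inr ⟨by omega, d, by omega, h2,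
            fun s hs hs' => h3 s hs (by omega)⟩⟩
      · rintro (h | ⟨hp, h | ⟨-, d, h1, h2, h3⟩⟩)
        · exact ⟨_, le_rfl, h, fun s _ _ => by omega⟩
        · simp at h
        · refine ⟨d, by omega, h2, fun s hs hs' => ?_⟩
          rcases hs'.eq_or_lt with rfl | hs'
          · exact hp
          · exact h3 s hs (by omega)

theorem before_mono {first d x x' : Prop} (hx : x → x') : before first d x → before first d x' :=
  Or.imp_right (And.imp_right hx)

/-- Unrolling into the past stops at position `0`, so no fairness condition is needed. -/
theorem past_of_unroll {u : Bool} {p q z : ℕ → Prop}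
    (h : ∀ t, z t → unroll u (p t) (q t) (before (t = 0) (u = false) (z (t - 1)))) {t : ℕ}
    (ht : z t) : past u p q t := by
  induction t with
  | zero =>
    refine past_iff_unroll.2 (unroll_mono id id ?_ (h 0 ht))
    rintro (h | h)
    · exact Or.inl h
    · exact absurd rfl h.1
  | succ t ih => exact past_iff_unroll.2 (unroll_mono id id (before_mono ih) (h _ ht))

/-! ### Soundness and completeness of the tableau -/

variable {w : List ℕ} {π : ℕ → Set V} {a : ℕ → ℕ → Prop} {X : ℕ → ℕ → Bool → Prop}

/-- Labels are only claims: a position may carry both signs or none at a given time, and the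
constraints go from a label to its reasons. Moments without any postponed eventuality supply the
fairness for every until at once. -/
theorem IsTableau.bsat (hX : IsTableau w a X) (ha : ∀ t v, a t (e v : ℕ) ↔ v ∈ π t)
    (hp : ∀ T, ∃ t, T ≤ t ∧ ¬ Pending w (X t)) (φ : LTL V) {i : ℕ} (hφ : SubAt e w i φ) {b : Bool}
    {t : ℕ} (h : X t i b) : bsat ⊤ π φ b t := by
  have hi := hφ.lt_length
  induction φ generalizing i b t with
  | tru =>
    obtain ⟨r, hr⟩ := hφ
    exact (hX.next t i hi b h).1 (getD_of_drop hr)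
  | fls =>
    obtain ⟨r, hr⟩ := hφ
    exact (hX.next t i hi b h).2.1 (getD_of_drop hr)
  | var v =>
    obtain ⟨r, hr⟩ := hφ
    have hc := getD_of_drop hr
    have := (hX.next t i hi b h).2.2.2.2.2.2.2.2
    rw [hc] at this
    simp only [le_add_iff_nonneg_right, zero_le, Nat.add_sub_cancel_left, ha, forall_const] at this
    exact this
  | neg φ ih =>
    obtain ⟨r, hr⟩ := hφ
    have h1 := subAt_of_drop hr
    exact ih h1 ((hX.next t i hi b h).2.2.1 (getD_of_drop hr)) h1.lt_length
  | conj φ ψ ih ih' =>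
    obtain ⟨r, hr⟩ := hφ
    rw [LTL.toWord, List.cons_append, List.append_assoc] at hr
    have h1 := subAt_of_drop hr
    have h2 := subAt_secondArg_of_drop hr
    exact conn_mono (ih h1 · h1.lt_length) (ih' h2 · h2.lt_length)
      ((hX.next t i hi b h).2.2.2.1 (getD_of_drop hr))
  | disj φ ψ ih ih' =>
    obtain ⟨r, hr⟩ := hφ
    rw [LTL.toWord, List.cons_append, List.append_assoc] at hr
    have h1 := subAt_of_drop hr
    have h2 := subAt_secondArg_of_drop hr
    exact conn_mono (ih h1 · h1.lt_length) (ih' h2 · h2.lt_length)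
      ((hX.next t i hi b h).2.2.2.2.1 (getD_of_drop hr))
  | nxt φ ih =>
    obtain ⟨r, hr⟩ := hφ
    have h1 := subAt_of_drop hr
    exact ih h1 ((hX.next t i hi b h).2.2.2.2.2.1 (getD_of_drop hr)) h1.lt_length
  | sUntil φ ψ ih ih' =>
    obtain ⟨r, hr⟩ := hφ
    rw [LTL.toWord, List.cons_append, List.append_assoc] at hr
    have h1 := subAt_of_drop hr
    have h2 := subAt_secondArg_of_drop hr
    have hc := getD_of_drop hr
    refine fut_of_unroll (z := fun t => X t i b) (fun t ht =>
      unroll_mono (ih h1 · h1.lt_length) (ih' h2 · h2.lt_length) id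
        ((hX.next t i hi b ht).2.2.2.2.2.2.1 hc)) ?_ h
    rintro rfl T
    obtain ⟨t, ht, hn⟩ := hp T
    refine ⟨t, ht, fun hz => ih' h2 ?_ h2.lt_length⟩
    by_contra hx
    exact hn ⟨i, hi, true, Or.inl ⟨hc, rfl⟩, hz, hx⟩
  | wBefore φ ψ ih ih' =>
    obtain ⟨r, hr⟩ := hφ
    rw [LTL.toWord, List.cons_append, List.append_assoc] at hr
    have h1 := subAt_of_drop hr
    have h2 := subAt_secondArg_of_drop hr
    have hc := getD_of_drop hr
    refine fut_of_unroll (z := fun t => X t i b) (fun t ht =>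
      unroll_mono (ih h1 · h1.lt_length) (ih' h2 · h2.lt_length) id
        ((hX.next t i hi b ht).2.2.2.2.2.2.2.1 hc)) ?_ h
    intro hb T
    obtain rfl : b = false := by simpa using hb
    obtain ⟨t, ht, hn⟩ := hp T
    refine ⟨t, ht, fun hz => ih' h2 ?_ h2.lt_length⟩
    by_contra hx
    exact hn ⟨i, hi, false, Or.inr ⟨hc, rfl⟩, hz, hx⟩
  | wPrev φ ih =>
    obtain ⟨r, hr⟩ := hφ
    have h1 := subAt_of_drop hr
    refine prev_iff_before.2 (before_mono (ih h1 · h1.lt_length) ?_)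
    simpa using (hX.prev t i hi b h).1 (getD_of_drop hr)
  | sPrev φ ih =>
    obtain ⟨r, hr⟩ := hφ
    have h1 := subAt_of_drop hr
    exact prev_iff_before.2 (before_mono (ih h1 · h1.lt_length)
      ((hX.prev t i hi b h).2.1 (getD_of_drop hr)))
  | pSUntil φ ψ ih ih' =>
    obtain ⟨r, hr⟩ := hφ
    rw [LTL.toWord, List.cons_append, List.append_assoc] at hr
    have h1 := subAt_of_drop hr
    have h2 := subAt_secondArg_of_drop hr
    exact past_of_unroll (z := fun t => X t i b) (fun t ht =>
      unroll_mono (ih h1 · h1.lt_length) (ih' h2 · h2.lt_length) id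
        ((hX.prev t i hi b ht).2.2.1 (getD_of_drop hr))) h
  | pBefore φ ψ ih ih' =>
    obtain ⟨r, hr⟩ := hφ
    rw [LTL.toWord, List.cons_append, List.append_assoc] at hr
    have h1 := subAt_of_drop hr
    have h2 := subAt_secondArg_of_drop hr
    refine past_of_unroll (z := fun t => X t i b) (fun t ht =>
      unroll_mono (ih h1 · h1.lt_length) (ih' h2 · h2.lt_length) ?_
        ((hX.prev t i hi b ht).2.2.2 (getD_of_drop hr))) h
    simp

/-- The labelling of the positions by the truth values that are witnessed with bound `N`. -/
def truthLabelling (e : V ≃ Fin k) (w : List ℕ) (π : ℕ → Set V) (N t i : ℕ) (b : Bool) : Prop :=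
  ∃ φ, SubAt e w i φ ∧ bsat N π φ b t

theorem isTableau_truthLabelling (ha : ∀ t v, a t (e v : ℕ) ↔ v ∈ π t) (N : ℕ) :
    IsTableau w a (truthLabelling e w π N) := by
  constructor
  all_goals
    rintro t i - b ⟨φ, hs, hφ⟩
    obtain ⟨r, hr⟩ := id hs
    -- The code at position `i` is the head symbol of `φ`, so only one clause of the constraints
    -- applies. Quantifying over `φ` in the labelling makes unique readability unnecessary.
    cases φ
    all_goals
      try rw [LTL.toWord, List.cons_append, List.append_assoc] at hr
      have hc := getD_of_drop hr
      simp only [NextOK, PrevOK, hc]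
      norm_num
    all_goals
      try have h1 := subAt_of_drop hr
      try have h2 := subAt_secondArg_of_drop hr
  · exact hφ
  · exact hφ
  · refine ⟨?_, ?_, ?_, ?_, ?_, ?_, ?_, (ha _ _).trans hφ⟩ <;> exact fun h => absurd h (by omega)
  · exact ⟨_, h1, hφ⟩
  · exact conn_mono (⟨_, h1, ·⟩) (⟨_, h2, ·⟩) hφ
  · exact conn_mono (⟨_, h1, ·⟩) (⟨_, h2, ·⟩) hφ
  · exact ⟨_, h1, hφ⟩
  · exact unroll_mono (⟨_, h1, ·⟩) (⟨_, h2, ·⟩) (fun h => ⟨_, hs, h⟩) (fut_unroll hφ)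
  · exact unroll_mono (⟨_, h1, ·⟩) (⟨_, h2, ·⟩) (fun h => ⟨_, hs, h⟩) (fut_unroll hφ)
  · refine ⟨?_, ?_, ?_, ?_⟩ <;> exact fun h => absurd h (by omega)
  · exact before_mono (⟨_, h1, ·⟩) (by simpa using prev_iff_before.1 hφ)
  · exact before_mono (⟨_, h1, ·⟩) (prev_iff_before.1 hφ)
  · exact unroll_mono (⟨_, h1, ·⟩) (⟨_, h2, ·⟩) (before_mono fun h => ⟨_, hs, h⟩)
      (past_iff_unroll.1 hφ)
  · refine unroll_mono (⟨_, h1, ·⟩) (⟨_, h2, ·⟩) (fun h => ?_) (past_iff_unroll.1 hφ)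
    rw [Bool.not_eq_false'] at h
    exact before_mono (fun h => ⟨_, hs, h⟩) h

theorem not_pending_truthLabelling {N t : ℕ} (ht : N ≤ t) :
    ¬ Pending w (truthLabelling e w π N t) := by
  rintro ⟨i, -, b, hc, ⟨φ, ⟨r, hr⟩, hφ⟩, hn⟩
  -- At `t ≥ N` a witness that is at most `N` can only be `t` itself.
  have key (p q : ℕ → Prop) (h : fut N true p q t) : q t := by
    obtain ⟨d, h1, rfl | h2, h3, -⟩ := h
    · exact h3
    · obtain rfl : d = t := by have : d ≤ N := by exact_mod_cast h2
                               omega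
      exact h3
  cases φ
  all_goals
    try rw [LTL.toWord, List.cons_append, List.append_assoc] at hr
    rw [getD_of_drop hr] at hc
  all_goals try (exfalso; omega)
  · obtain rfl : b = true := by simpa using hc
    exact hn ⟨_, subAt_secondArg_of_drop hr, key _ _ hφ⟩
  · obtain rfl : b = false := by simpa using hc
    exact hn ⟨_, subAt_secondArg_of_drop hr, key _ _ hφ⟩

end

section

/-! ### The breakpoint construction -/

/-- Otherwise every `q` in `S` fails from some stage on, and past the largest of these finitely many
stages none is left. -/
theorem exists_mem_forall_of_antitone {Q : Type*} {S : Set Q} (hS : S.Finite) {p : ℕ → Q → Prop}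
    (hp : ∀ n q, p (n + 1) q → p n q) (h : ∀ n, ∃ q ∈ S, p n q) : ∃ q ∈ S, ∀ n, p n q := by
  by_contra! H
  choose! f hf using H
  obtain ⟨N, hN⟩ := (hS.image f).bddAbove
  obtain ⟨q, hq, hpq⟩ := h N
  have hle : f q ≤ N := hN ⟨q, hq, rfl⟩
  refine hf q hq ?_
  clear hN
  induction N, hle using Nat.le_induction with
  | base => exact hpq
  | succ n _ ih => exact ih (hp n q hpq)

/-- There is a path of length `n` that starts in `q` at level `s` and stays in the levels `Z`. -/
def HasPath {Q : Type*} (Z : ℕ → Set Q) (R : ℕ → Q → Q → Prop) : ℕ → ℕ → Q → Prop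
  | 0, s, q => q ∈ Z s
  | n + 1, s, q => q ∈ Z s ∧ ∃ q', R s q q' ∧ HasPath Z R n (s + 1) q'

section
variable {Q : Type*} {Z : ℕ → Set Q} {R : ℕ → Q → Q → Prop}

theorem HasPath.mem {n s : ℕ} {q : Q} (h : HasPath Z R n s q) : q ∈ Z s := by
  cases n with
  | zero => exact h
  | succ n => exact h.1

theorem HasPath.pred {n s : ℕ} {q : Q} (h : HasPath Z R (n + 1) s q) : HasPath Z R n s q := by
  induction n generalizing s q with
  | zero => exact h.mem
  | succ n ih =>
    obtain ⟨h1, q', h2, h3⟩ := h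
    exact ⟨h1, q', h2, ih h3⟩

/-- König's lemma for layered graphs. -/
theorem exists_path (hfin : ∀ s, (Z s).Finite) (hne : ∀ s, (Z s).Nonempty)
    (hR : ∀ s, ∀ q' ∈ Z (s + 1), ∃ q ∈ Z s, R s q q') :
    ∃ ρ : ℕ → Q, ∀ s, ρ s ∈ Z s ∧ R s (ρ s) (ρ (s + 1)) := by
  -- Finite paths are built backwards: states are known to have predecessors, not successors.
  have key : ∀ n s, ∃ q ∈ Z s, HasPath Z R n s q := by
    intro n
    induction n with
    | zero => exact fun s => let ⟨q, hq⟩ := hne s; ⟨q, hq, hq⟩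
    | succ n ih =>
      intro s
      obtain ⟨q', hq', h⟩ := ih (s + 1)
      obtain ⟨q, hq, hqq'⟩ := hR s q' hq'
      exact ⟨q, hq, hq, q', hqq', h⟩
  obtain ⟨q₀, -, h₀⟩ := exists_mem_forall_of_antitone (hfin 0)
    (p := fun n q => HasPath Z R n 0 q) (fun n q h => h.pred)
    (fun n => key n 0)
  -- Of the finitely many successors, one keeps paths of every length.
  have step (s : ℕ) (q : {q // ∀ n, HasPath Z R n s q}) :
      ∃ q' : {q // ∀ n, HasPath Z R n (s + 1) q}, R s q q' := by
    obtain ⟨q', -, h⟩ := exists_mem_forall_of_antitone (hfin (s + 1))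
      (p := fun n q' => R s q q' ∧ HasPath Z R n (s + 1) q') (fun n q h => ⟨h.1, h.2.pred⟩)
      (fun n => let ⟨_, q', h1, h2⟩ := q.2 (n + 1); ⟨q', h2.mem, h1, h2⟩)
    exact ⟨⟨q', fun n => (h n).2⟩, (h 0).1⟩
  choose f hf using step
  let ρ (s : ℕ) : {q // ∀ n, HasPath Z R n s q} :=
    Nat.rec ⟨q₀, h₀⟩ (fun s q => f s q) s
  exact ⟨fun s => (ρ s).1, fun s => ⟨(ρ s).2 0, hf s (ρ s)⟩⟩

/-- The breakpoint construction: `P` is the sequence of reachable sets, `O` the sequence of the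
sets of states that have avoided `bad` since `O` was empty the last time. -/
theorem breakpoint {init : Set Q} {bad : Set Q} {P O : ℕ → Set Q} (hP0 : P 0 = init)
    (hP : ∀ t, P (t + 1) = {q' | ∃ q ∈ P t, R t q q'})
    (hO0 : O 0 = ∅) (hO : ∀ t, O (t + 1) =
      {q' | (∃ q, (q ∈ O t ∨ (O t = ∅ ∧ q ∈ P t)) ∧ R t q q') ∧ q' ∉ bad})
    (hfin : ∀ t, (P t).Finite) :
    (∀ i, ∃ j, i ≤ j ∧ O j = ∅) ↔ ∀ ρ : ℕ → Q, ρ 0 ∈ init → (∀ t, R t (ρ t) (ρ (t + 1))) →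
      ∀ i, ∃ j, i ≤ j ∧ ρ j ∈ bad := by
  have hOP (t : ℕ) : O t ⊆ P t := by
    induction t with
    | zero => simp [hO0]
    | succ t ih =>
      rw [hO, hP]
      rintro q' ⟨⟨q, h1 | h1, h2⟩, -⟩
      · exact ⟨q, ih h1, h2⟩
      · exact ⟨q, h1.2, h2⟩
  constructor
  · intro h ρ h0 hρ i
    by_contra! hb
    have hPρ (t : ℕ) : ρ t ∈ P t := by
      induction t with
      | zero => rwa [hP0]
      | succ t ih => rw [hP]; exact ⟨_, ih, hρ t⟩
    obtain ⟨j, hj, hOj⟩ := h i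
    obtain ⟨j', hj', hOj'⟩ := h (j + 1)
    -- A run that avoids `bad` enters `O` right after the breakpoint `j` and can never leave it, so
    -- `O` cannot be empty again.
    suffices ρ j' ∈ O j' by simp [hOj'] at this
    clear hOj'
    induction j', hj' using Nat.le_induction with
    | base => rw [hO]; exact ⟨⟨_, Or.inr ⟨hOj, hPρ j⟩, hρ j⟩, hb _ (by omega)⟩
    | succ n hn ih => rw [hO]; exact ⟨⟨_, Or.inl ih, hρ n⟩, hb _ (by omega)⟩
  · intro h T
    by_contra! hne
    -- If `O` is never empty from `T` on, it is never refilled from `P`, so each of its states has a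
    -- predecessor in the preceding `O`. Prefixing the reachable sets leads back to an initial
    -- state.
    let Z (s : ℕ) : Set Q := if s < T then P s else O s
    have hZP (s : ℕ) : Z s ⊆ P s := by
      by_cases hs : s < T
      · simp [Z, hs]
      · simpa [Z, hs] using hOP s
    have hPne (s : ℕ) (hs : s ≤ T) : (P s).Nonempty := by
      induction hs using Nat.decreasingInduction with
      | self => exact (hne T le_rfl).mono (hOP T)
      | of_succ s _ ih =>
        obtain ⟨q', hq'⟩ := ih
        rw [hP] at hq'
        obtain ⟨q, hq, -⟩ := hq'
        exact ⟨q, hq⟩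
    obtain ⟨ρ, hρ⟩ := exists_path (Z := Z) (R := R) (fun s => (hfin s).subset (hZP s))
      (fun s => by
        by_cases hs : s < T
        · simpa [Z, hs] using hPne s hs.le
        · simpa [Z, hs] using hne s (by omega))
      (fun s q' hq' => by
        by_cases hs : s < T
        · have := hZP _ hq'
          rw [hP] at this
          simpa [Z, hs] using this
        · simp only [Z, hs, show ¬ s + 1 < T by omega, if_false] at hq' ⊢
          rw [hO] at hq'
          obtain ⟨⟨q, h1 | h1, h2⟩, -⟩ := hq'
          · exact ⟨q, h1, h2⟩
          · exact absurd h1.1 (hne s (by omega)).ne_empty)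
    -- Starting at `T + 1` makes `j` a successor, so that the recursion for `O j` excludes `bad`.
    obtain ⟨j, hj, hb⟩ := h ρ (by rw [← hP0]; exact hZP 0 (hρ 0).1) (fun t => (hρ t).2) (T + 1)
    have hj' := (hρ j).1
    simp only [Z, show ¬ j < T by omega, if_false] at hj'
    obtain ⟨j, rfl⟩ : ∃ n, j = n + 1 := ⟨j - 1, by omega⟩
    rw [hO] at hj'
    exact hj'.2 hb

end

end

section

/-! ### The automaton as a table -/

open Classical in
/-- The number whose binary digits below `m` are given by `p`. -/
noncomputable def bitMask (m : ℕ) (p : ℕ → Prop) : ℕ :=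
  ∑ i ∈ Finset.range m, if p i then 2 ^ i else 0

theorem bitMask_lt (m : ℕ) (p : ℕ → Prop) : bitMask m p < 2 ^ m := by
  induction m with
  | zero => simp [bitMask]
  | succ m ih =>
    rw [bitMask, Finset.sum_range_succ, ← bitMask, pow_succ]
    split <;> omega

theorem testBit_bitMask (m : ℕ) (p : ℕ → Prop) (i : ℕ) :
    (bitMask m p).testBit i = true ↔ i < m ∧ p i := by
  induction m with
  | zero => simp [bitMask]
  | succ m ih =>
    rw [bitMask, Finset.sum_range_succ, ← bitMask]
    have hlt := bitMask_lt m p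
    split
    next hm =>
      rw [add_comm]
      rcases lt_trichotomy i m with h | rfl | h
      · rw [Nat.testBit_two_pow_add_gt h, ih]
        simp [h, h.trans (Nat.lt_succ_self m)]
      · simp [Nat.testBit_two_pow_add_eq, Nat.testBit_lt_two_pow hlt, hm]
      · have : 2 ^ m + bitMask m p < 2 ^ i :=
          calc 2 ^ m + bitMask m p < 2 ^ (m + 1) := by rw [pow_succ]; omega
            _ ≤ 2 ^ i := Nat.pow_le_pow_right two_pos h
        simp [Nat.testBit_lt_two_pow this, show ¬ i < m + 1 by omega]
    next hm =>
      rw [add_zero, ih]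
      constructor
      · exact fun h => ⟨h.1.trans (Nat.lt_succ_self m), h.2⟩
      · rintro ⟨h1, h2⟩
        exact ⟨Nat.lt_of_le_of_ne (Nat.le_of_lt_succ h1) (by rintro rfl; exact hm h2), h2⟩

variable {V : Type*} {k : ℕ}

theorem letterIndex_eq_bitMask (e : V ≃ Fin k) (s : Set V) :
    letterIndex e s = bitMask k (fun i => ∃ v ∈ s, (e v : ℕ) = i) := by
  classical
  rw [letterIndex, bitMask, ← Fin.sum_univ_eq_sum_range
    (fun i => if ∃ v ∈ s, (e v : ℕ) = i then 2 ^ i else 0)]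
  refine Finset.sum_congr rfl fun i _ => if_congr ?_ rfl rfl
  constructor
  · exact fun h => ⟨_, h, by simp⟩
  · rintro ⟨v, hv, h⟩
    rwa [← Fin.ext h, e.symm_apply_apply]

theorem letterIndex_lt (e : V ≃ Fin k) (s : Set V) : letterIndex e s < 2 ^ k := by
  rw [letterIndex_eq_bitMask]
  exact bitMask_lt _ _

theorem testBit_letterIndex (e : V ≃ Fin k) (s : Set V) (v : V) :
    (letterIndex e s).testBit (e v) = true ↔ v ∈ s := by
  rw [letterIndex_eq_bitMask, testBit_bitMask]
  constructor
  · rintro ⟨-, v', h, h'⟩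
    rwa [← e.injective (Fin.ext h')]
  · exact fun h => ⟨(e v).2, v, h, rfl⟩

/-- The labelling with the code `q`. -/
def label (q i : ℕ) (b : Bool) : Prop := q.testBit (2 * i + b.toNat) = true

/-- The transition relation of the tableau on codes of labellings. -/
def TableauStep (w : List ℕ) (a q q' : ℕ) : Prop :=
  ∀ i < w.length, ∀ b,
    (label q i b → NextOK w (fun v => a.testBit v = true) (label q) (label q') i b) ∧
    (label q' i b → PrevOK w False (label q') (label q) i b)

/-- The initial states of the tableau that claim the whole formula to be false. -/
def TableauStart (w : List ℕ) (q : ℕ) : Prop :=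
  label q 0 false ∧ ∀ i < w.length, ∀ b, label q i b → PrevOK w True (label q) (label q) i b

/-- The number of states of the tableau. -/
def tableauSize (w : List ℕ) : ℕ := 2 ^ (2 * w.length)

/-- The transition function of the breakpoint construction on codes of pairs of sets. -/
noncomputable def breakpointStep (w : List ℕ) (n a : ℕ) : ℕ :=
  bitMask (tableauSize w) (fun q' => ∃ q < tableauSize w,
    (n % 2 ^ tableauSize w).testBit q = true ∧ TableauStep w a q q') +
  2 ^ tableauSize w * bitMask (tableauSize w) (fun q' => (∃ q < tableauSize w,
    ((n / 2 ^ tableauSize w).testBit q = true ∨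
      (n / 2 ^ tableauSize w = 0 ∧ (n % 2 ^ tableauSize w).testBit q = true)) ∧
      TableauStep w a q q') ∧ ¬ Pending w (label q'))

/-- The deterministic Büchi automaton for the formula with the word `w` over `k` variables. -/
noncomputable def compileWord (k : ℕ) (w : List ℕ) : BuchiTable :=
  (2 ^ tableauSize w * 2 ^ tableauSize w - 1, bitMask (tableauSize w) (TableauStart w),
    (List.range (2 ^ tableauSize w * 2 ^ tableauSize w)).map fun n =>
      (List.range (2 ^ k)).map fun a => breakpointStep w n a,
    List.range (2 ^ tableauSize w))

theorem breakpointStep_lt (w : List ℕ) (n a : ℕ) :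
    breakpointStep w n a < 2 ^ tableauSize w * 2 ^ tableauSize w := by
  unfold breakpointStep
  refine (Nat.add_lt_add_right (bitMask_lt _ _) _).trans_le ?_
  rw [← mul_one_add]
  refine Nat.mul_le_mul_left _ ?_
  rw [add_comm]
  exact bitMask_lt _ _

theorem testBit_breakpointStep_mod (w : List ℕ) (n a q' : ℕ) :
    (breakpointStep w n a % 2 ^ tableauSize w).testBit q' = true ↔ q' < tableauSize w ∧
      ∃ q < tableauSize w, (n % 2 ^ tableauSize w).testBit q = true ∧ TableauStep w a q q' := by
  rw [breakpointStep, Nat.add_mul_mod_self_left, Nat.mod_eq_of_lt (bitMask_lt _ _),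
    testBit_bitMask]

theorem testBit_breakpointStep_div (w : List ℕ) (n a q' : ℕ) :
    (breakpointStep w n a / 2 ^ tableauSize w).testBit q' = true ↔ q' < tableauSize w ∧
      (∃ q < tableauSize w, ((n / 2 ^ tableauSize w).testBit q = true ∨
        (n / 2 ^ tableauSize w = 0 ∧ (n % 2 ^ tableauSize w).testBit q = true)) ∧
        TableauStep w a q q') ∧ ¬ Pending w (label q') := by
  rw [breakpointStep, Nat.add_mul_div_left _ _ (Nat.two_pow_pos _),
    Nat.div_eq_of_lt (bitMask_lt _ _), zero_add, testBit_bitMask]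

theorem lt_of_testBit {n m q : ℕ} (hn : n < 2 ^ m) (h : n.testBit q = true) : q < m := by
  by_contra hq
  have := Nat.testBit_lt_two_pow (hn.trans_le (Nat.pow_le_pow_right two_pos (not_lt.1 hq)))
  simp [this] at h

/-! ### Runs and acceptance of the compiled table -/

/-- The run of the compiled automaton, as a sequence of numbers. -/
noncomputable def numRun (w : List ℕ) (a : ℕ → ℕ) : ℕ → ℕ
  | 0 => bitMask (tableauSize w) (TableauStart w)
  | t + 1 => breakpointStep w (numRun w a t) (a t)

theorem numRun_lt (w : List ℕ) (a : ℕ → ℕ) (t : ℕ) :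
    numRun w a t < 2 ^ tableauSize w * 2 ^ tableauSize w := by
  cases t with
  | zero => exact (bitMask_lt _ _).trans_le (Nat.le_mul_of_pos_left _ (Nat.two_pow_pos _))
  | succ t => exact breakpointStep_lt _ _ _

/-- A state is the number `P + 2 ^ tableauSize w * O`, so being below `2 ^ tableauSize w` means that
the breakpoint set is empty. -/
theorem numRun_infOften_iff (w : List ℕ) (a : ℕ → ℕ) :
    (∀ i, ∃ j, i ≤ j ∧ numRun w a j < 2 ^ tableauSize w) ↔
      ∀ ρ : ℕ → ℕ, (∀ t, ρ t < tableauSize w) → TableauStart w (ρ 0) →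
        (∀ t, TableauStep w (a t) (ρ t) (ρ (t + 1))) →
        ∀ i, ∃ j, i ≤ j ∧ Pending w (label (ρ j)) := by
  have hdiv (t : ℕ) : numRun w a t / 2 ^ tableauSize w < 2 ^ tableauSize w :=
    Nat.div_lt_of_lt_mul (numRun_lt w a t)
  have hmod (t : ℕ) : numRun w a t % 2 ^ tableauSize w < 2 ^ tableauSize w :=
    Nat.mod_lt _ (Nat.two_pow_pos _)
  have hO (t : ℕ) : {q | (numRun w a t / 2 ^ tableauSize w).testBit q = true} = ∅ ↔
      numRun w a t / 2 ^ tableauSize w = 0 := by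
    constructor
    · intro h
      refine Nat.zero_of_testBit_eq_false fun q => ?_
      simpa using Set.eq_empty_iff_forall_notMem.1 h q
    · intro h
      simp [h]
  have h0 : numRun w a 0 / 2 ^ tableauSize w = 0 := Nat.div_eq_of_lt (bitMask_lt _ _)
  -- Codes must stay below `tableauSize w`, since the bit masks forget all larger ones.
  have key := breakpoint (R := fun t q q' => TableauStep w (a t) q q' ∧ q' < tableauSize w)
    (init := {q | q < tableauSize w ∧ TableauStart w q}) (bad := {q | Pending w (label q)})
    (P := fun t => {q | (numRun w a t % 2 ^ tableauSize w).testBit q = true})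
    (O := fun t => {q | (numRun w a t / 2 ^ tableauSize w).testBit q = true})
    (by
      ext q
      simp only [numRun, Nat.mod_eq_of_lt (bitMask_lt _ _), Set.mem_ofPred_eq, testBit_bitMask])
    (fun t => by
      ext q'
      simp only [numRun, Set.mem_ofPred_eq, testBit_breakpointStep_mod]
      constructor
      · rintro ⟨h1, q, -, h2, h3⟩
        exact ⟨q, h2, h3, h1⟩
      · rintro ⟨q, h2, h3, h1⟩
        exact ⟨h1, q, lt_of_testBit (hmod t) h2, h2, h3⟩)
    ((hO 0).2 h0)
    (fun t => by
      ext q'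
      simp only [hO]
      simp only [numRun, Set.mem_ofPred_eq, testBit_breakpointStep_div]
      constructor
      · rintro ⟨h1, ⟨q, -, h2, h3⟩, h4⟩
        exact ⟨⟨q, h2, h3, h1⟩, h4⟩
      · rintro ⟨⟨q, h2, h3, h1⟩, h4⟩
        exact ⟨h1, ⟨q, h2.elim (lt_of_testBit (hdiv t)) fun h => lt_of_testBit (hmod t) h.2,
          h2, h3⟩, h4⟩)
    (fun t => (Set.finite_Iio (tableauSize w)).subset fun q hq => lt_of_testBit (hmod t) hq)
  simp only [hO, Nat.div_eq_zero_iff, (Nat.two_pow_pos _).ne', false_or] at key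
  rw [key]
  constructor
  · exact fun h ρ h1 h2 h3 => h ρ ⟨h1 0, h2⟩ fun t => ⟨h3 t, h1 _⟩
  · refine fun h ρ h1 h2 => h ρ (fun t => ?_) h1.2 fun t => (h2 t).1
    cases t with
    | zero => exact h1.1
    | succ t => exact (h2 t).2

theorem compileWord_run (e : V ≃ Fin k) (w : List ℕ) (α : ℕ → Set V)
    (β : ℕ → Fin ((compileWord k w).1 + 1)) :
    ((compileWord k w).toDetBuchi e).toOmega.IsRun α β ↔
      ∀ t, (β t : ℕ) = numRun w (fun t => letterIndex e (α t)) t := by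
  have hN : (compileWord k w).1 + 1 = 2 ^ tableauSize w * 2 ^ tableauSize w :=
    Nat.sub_add_cancel (Nat.mul_pos (Nat.two_pow_pos _) (Nat.two_pow_pos _))
  -- The reduction modulo the number of states in reading the table thus has no effect along the
  -- run.
  have hmod (t : ℕ) := Nat.mod_eq_of_lt (hN.symm ▸ numRun_lt w (fun t => letterIndex e (α t)) t)
  have hstep (t : ℕ) (q : Fin ((compileWord k w).1 + 1))
      (hq : (q : ℕ) = numRun w (fun t => letterIndex e (α t)) t) :
      ((((compileWord k w).toDetBuchi e).step q (α t) : Fin _) : ℕ) =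
        numRun w (fun t => letterIndex e (α t)) (t + 1) := by
    rw [← hmod (t + 1)]
    simp only [BuchiTable.toDetBuchi, Fin.ofNat]
    congr 1
    have hq' : (q : ℕ) < 2 ^ tableauSize w * 2 ^ tableauSize w := hN ▸ q.2
    rw [numRun, ← hq]
    simp [compileWord, List.getD, List.getElem?_map, List.getElem?_range hq',
      List.getElem?_range (letterIndex_lt e (α t))]
  constructor
  · rintro ⟨h0, h⟩ t
    induction t with
    | zero => rw [show β 0 = _ from h0, ← hmod 0]; rfl
    | succ t ih => rw [show β (t + 1) = _ from h t]; exact hstep t _ ih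
  · refine fun h => ⟨Fin.ext ?_, fun t => Fin.ext ?_⟩
    · rw [h 0, ← hmod 0]; rfl
    · rw [h (t + 1)]; exact (hstep t _ (h t)).symm

theorem compileWord_accepts_iff (e : V ≃ Fin k) (w : List ℕ) (α : ℕ → Set V) :
    ((compileWord k w).toDetBuchi e).toOmega.Accepts α ↔
      ∀ i, ∃ j, i ≤ j ∧ numRun w (fun t => letterIndex e (α t)) j < 2 ^ tableauSize w := by
  have hN : (compileWord k w).1 + 1 = 2 ^ tableauSize w * 2 ^ tableauSize w :=
    Nat.sub_add_cancel (Nat.mul_pos (Nat.two_pow_pos _) (Nat.two_pow_pos _))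
  have hacc (β : ℕ → Fin ((compileWord k w).1 + 1)) :
      ((compileWord k w).toDetBuchi e).toOmega.acceptance β ↔
        ∀ i, ∃ j, i ≤ j ∧ (β j : ℕ) < 2 ^ tableauSize w := by
    simp [DetBuchi.toOmega, OmegaAutomaton.ofFun, InfOften, BuchiTable.toDetBuchi, compileWord]
    rfl
  constructor
  · rintro ⟨β, hβ, h⟩
    rw [hacc] at h
    simpa only [(compileWord_run e w α β).1 hβ] using h
  · intro h
    refine ⟨fun t => ⟨numRun w (fun t => letterIndex e (α t)) t, hN ▸ numRun_lt _ _ _⟩,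
      (compileWord_run e w α _).2 fun t => rfl, (hacc _).2 h⟩

/-- Membership in `GF` enters only to show that accepted words satisfy `φ`: a violation must have a
finite bound, which gives a run with finitely many pending states. The other direction is soundness
of the tableau. -/
theorem compileWord_initiallyEquivalent (e : V ≃ Fin k) {φ : LTL V}
    (hφ : Derives Nonterminal.GF φ) :
    ((compileWord k (φ.toWord e)).toDetBuchi e).toOmega.InitiallyEquivalent φ := by
  intro α
  set w := φ.toWord e with hw
  have ha (t : ℕ) (v : V) := testBit_letterIndex e (α t) v
  have hroot : SubAt e w 0 φ := ⟨[], by simp [hw]⟩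
  rw [compileWord_accepts_iff, numRun_infOften_iff]
  constructor
  · intro h
    by_contra hsat
    obtain ⟨N, -, hN⟩ := hφ.classBounded α 0 ((bsat_top α φ 0).2.2 hsat)
    have hX := isTableau_truthLabelling (w := w) (π := α)
      (a := fun t v => (letterIndex e (α t)).testBit v = true) ha N
    -- Bit `2 * i + b.toNat` stands for position `i` with sign `b`; quotient and remainder by `2`
    -- recover the pair.
    let ρ (t : ℕ) : ℕ := bitMask (2 * w.length)
      (fun j => truthLabelling e w α N t (j / 2) (decide (j % 2 = 1)))
    have hρ (t : ℕ) : label (ρ t) = truthLabelling e w α N t := by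
      funext i b
      have h1 : (2 * i + b.toNat) / 2 = i := by cases b <;> simp; omega
      have h2 : decide ((2 * i + b.toNat) % 2 = 1) = b := by cases b <;> simp
      simp only [label, ρ, testBit_bitMask, h1, h2, eq_iff_iff, and_iff_right_iff_imp]
      rintro ⟨ψ, hψ, -⟩
      have := hψ.lt_length
      cases b <;> simp <;> omega
    obtain ⟨j, hj, hp⟩ := h ρ (fun t => bitMask_lt _ _)
      ⟨by rw [hρ]; exact ⟨φ, hroot, hN⟩, fun i hi b hb => by
        have := hX.prev 0 i hi b (by rwa [hρ] at hb)
        simpa [hρ] using this⟩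
      (fun t i hi b => ⟨fun hb => by
        have := hX.next t i hi b (by rwa [hρ] at hb)
        simpa only [hρ] using this, fun hb => by
        have := hX.prev (t + 1) i hi b (by rwa [hρ] at hb)
        simpa [hρ] using this⟩) N
    rw [hρ] at hp
    exact not_pending_truthLabelling hj hp
  · intro hsat ρ h1 h2 h3
    by_contra! hp
    obtain ⟨T, hT⟩ := hp
    refine (bsat_top α φ 0).2.1 (IsTableau.bsat (X := fun t => label (ρ t))
      (a := fun t v => (letterIndex e (α t)).testBit v = true) ⟨?_, ?_⟩ ha ?_ φ hroot h2.1) hsat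
    · exact fun t i hi b hb => (h3 t i hi b).1 hb
    · intro t i hi b hb
      cases t with
      -- Here `t - 1` truncates to `0`; the previous labelling is a dummy that the case `first`
      -- ignores.
      | zero => simpa using h2.2 i hi b hb
      | succ t => simpa using (h3 t i hi b).2 hb
    · exact fun T' => ⟨max T T', le_max_right _ _, hT _ (le_max_left _ _)⟩

end

section

/-! ### Computability of the table -/

section Computability
variable {α : Type*} [Primcodable α]

/-- Conditions on a fixed sign do not depend on the input, so it does not matter how they are
decided. Quantifiers over signs are later expanded into two such cases. -/
theorem primrecPred_const (p : Prop) : PrimrecPred fun _ : α => p := by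
  classical
  exact ⟨fun _ => inferInstance, Primrec.const _⟩

theorem primrecPred_imp {p q : α → Prop} (hp : PrimrecPred p) (hq : PrimrecPred q) :
    PrimrecPred fun x => p x → q x := (hp.not.or hq).of_eq fun _ => imp_iff_not_or.symm

theorem primrecPred_iff {p q : α → Prop} (hp : PrimrecPred p) (hq : PrimrecPred q) :
    PrimrecPred fun x => p x ↔ q x :=
  ((primrecPred_imp hp hq).and (primrecPred_imp hq hp)).of_eq fun _ => iff_def.symm

theorem primrecPred_exists_lt {f : α → ℕ} {p : α → ℕ → Prop} (hf : Primrec f)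
    (hp : PrimrecPred fun x : α × ℕ => p x.1 x.2) : PrimrecPred fun x => ∃ i < f x, p x i :=
  (PrimrecRel.comp (PrimrecRel.exists_mem_list (R := fun (i : ℕ) (x : α) => p x i)
    (hp.comp (Primrec.pair Primrec.snd Primrec.fst)))
    (Primrec.list_range.comp hf) Primrec.id).of_eq (by simp)

theorem primrecPred_forall_lt {f : α → ℕ} {p : α → ℕ → Prop} (hf : Primrec f)
    (hp : PrimrecPred fun x : α × ℕ => p x.1 x.2) : PrimrecPred fun x => ∀ i < f x, p x i :=
  (primrecPred_exists_lt (p := fun x i => ¬ p x i) hf hp.not).not.of_eq (by simp)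

theorem primrecPred_forall_bool {p : α → Bool → Prop}
    (hp : ∀ b, PrimrecPred fun x => p x b) : PrimrecPred fun x => ∀ b, p x b :=
  ((hp false).and (hp true)).of_eq fun _ => Bool.forall_bool.symm

theorem primrecPred_exists_bool {p : α → Bool → Prop}
    (hp : ∀ b, PrimrecPred fun x => p x b) : PrimrecPred fun x => ∃ b, p x b :=
  ((hp false).or (hp true)).of_eq fun _ => Bool.exists_bool.symm

theorem primrec_two_pow {f : α → ℕ} (hf : Primrec f) : Primrec fun x => 2 ^ f x :=
  (Primrec₂.unpaired'.1 Nat.Primrec.pow).comp (Primrec.const 2) hf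

theorem primrecPred_testBit {f g : α → ℕ} (hf : Primrec f) (hg : Primrec g) :
    PrimrecPred fun x => (f x).testBit (g x) = true :=
  (Primrec.eq.comp (Primrec.nat_mod.comp (Primrec.nat_div.comp hf (primrec_two_pow hg))
    (Primrec.const 2)) (Primrec.const 1)).of_eq fun x => by
      simp [Nat.testBit_eq_decide_div_mod_eq]

/-- Primitive recursion on the number of digits. Although `bitMask` is defined with classical
decisions, its values are those of an algorithm whenever the predicate is primitive recursive. -/
theorem primrec_bitMask {m : α → ℕ} {p : α → ℕ → Prop} (hm : Primrec m)
    (hp : PrimrecPred fun x : α × ℕ => p x.1 x.2) : Primrec fun x => bitMask (m x) (p x) := by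
  classical
  have h : Primrec₂ fun (x : α) (y : ℕ × ℕ) => y.2 + if p x y.1 then 2 ^ y.1 else 0 := by
    have h1 : Primrec fun z : α × ℕ × ℕ => z.2.1 := Primrec.fst.comp Primrec.snd
    exact Primrec.nat_add.comp (Primrec.snd.comp Primrec.snd)
      (Primrec.ite (hp.comp (Primrec.pair Primrec.fst h1)) (primrec_two_pow h1) (Primrec.const 0))
  refine (Primrec.nat_rec' hm (Primrec.const 0) h).of_eq fun x => ?_
  induction m x with
  | zero => simp [bitMask]
  | succ n ih =>
    simp only [bitMask, Finset.sum_range_succ] at ih ⊢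
    rw [← ih]

theorem primrec_formulaLengths : Primrec formulaLengths := by
  have hc : Primrec fun x : List ℕ × ℕ × List ℕ => x.2.1 := Primrec.fst.comp Primrec.snd
  have hl : Primrec fun x : List ℕ × ℕ × List ℕ => x.2.2 := Primrec.snd.comp Primrec.snd
  have h0 : Primrec fun x : List ℕ × ℕ × List ℕ => x.2.2.getD 0 0 :=
    (Primrec.list_getD 0).comp hl (Primrec.const 0)
  have heq (n : ℕ) : PrimrecPred fun x : List ℕ × ℕ × List ℕ => x.2.1 = n :=
    Primrec.eq.comp hc (Primrec.const n)
  have h1 : Primrec fun x : List ℕ × ℕ × List ℕ => 1 + x.2.2.getD 0 0 :=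
    Primrec.nat_add.comp (Primrec.const 1) h0
  exact Primrec.list_foldr Primrec.id (Primrec.const []) <| Primrec.to₂ (Primrec.list_cons.comp
    (Primrec.ite ((Primrec.nat_lt.comp hc (Primrec.const 2)).or
        (Primrec.nat_le.comp (Primrec.const 12) hc)) (Primrec.const 1)
      (Primrec.ite ((heq 2).or ((heq 5).or ((heq 8).or (heq 9)))) h1
        (Primrec.nat_add.comp h1 ((Primrec.list_getD 0).comp hl h0)))) hl)

variable {w : α → List ℕ} {i q q' a : α → ℕ}

theorem primrec_secondArg (hw : Primrec w) (hi : Primrec i) :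
    Primrec fun x => secondArg (w x) (i x) :=
  Primrec.nat_add.comp (Primrec.succ.comp hi)
    ((Primrec.list_getD 0).comp (primrec_formulaLengths.comp hw) (Primrec.succ.comp hi))

theorem primrecPred_label (hq : Primrec q) (hi : Primrec i) (b : Bool) :
    PrimrecPred fun x => label (q x) (i x) b :=
  primrecPred_testBit hq
    (Primrec.nat_add.comp (Primrec.nat_mul.comp (Primrec.const 2) hi) (Primrec.const _))

theorem primrecPred_conn (u : Bool) {p q : α → Prop} (hp : PrimrecPred p) (hq : PrimrecPred q) :
    PrimrecPred fun x => conn u (p x) (q x) := by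
  cases u
  · exact hp.or hq
  · exact hp.and hq

theorem primrecPred_unroll (u : Bool) {p q r : α → Prop} (hp : PrimrecPred p)
    (hq : PrimrecPred q) (hr : PrimrecPred r) : PrimrecPred fun x => unroll u (p x) (q x) (r x) := by
  cases u
  · exact hq.and (hp.or hr)
  · exact hq.or (hp.and hr)

theorem primrecPred_before (first d : Prop) {p : α → Prop} (hp : PrimrecPred p) :
    PrimrecPred fun x => before first d (p x) :=
  ((primrecPred_const _).and (primrecPred_const _)).or ((primrecPred_const _).and hp)

theorem primrecPred_code {n : ℕ} (hw : Primrec w) (hi : Primrec i) :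
    PrimrecPred fun x => (w x).getD (i x) 0 = n :=
  Primrec.eq.comp ((Primrec.list_getD 0).comp hw hi) (Primrec.const n)

theorem primrecPred_nextOK (hw : Primrec w) (ha : Primrec a) (hq : Primrec q) (hq' : Primrec q')
    (hi : Primrec i) (b : Bool) : PrimrecPred fun x =>
      NextOK (w x) (fun v => (a x).testBit v = true) (label (q x)) (label (q' x)) (i x) b := by
  have hc : Primrec fun x => (w x).getD (i x) 0 := (Primrec.list_getD 0).comp hw hi
  have hs := Primrec.succ.comp hi
  have h2 := primrec_secondArg hw hi
  have hn {n : ℕ} {p : α → Prop} (hp : PrimrecPred p) :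
      PrimrecPred fun x => (w x).getD (i x) 0 = n → p x :=
    primrecPred_imp (primrecPred_code hw hi) hp
  refine (hn (primrecPred_const _)).and <| (hn (primrecPred_const _)).and <|
    (hn (primrecPred_label hq hs _)).and <|
    (hn (primrecPred_conn _ (primrecPred_label hq hs _) (primrecPred_label hq h2 _))).and <|
    (hn (primrecPred_conn _ (primrecPred_label hq hs _) (primrecPred_label hq h2 _))).and <|
    (hn (primrecPred_label hq' hs _)).and <|
    (hn (primrecPred_unroll _ (primrecPred_label hq hs _) (primrecPred_label hq h2 _)
      (primrecPred_label hq' hi _))).and <|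
    (hn (primrecPred_unroll _ (primrecPred_label hq hs _) (primrecPred_label hq h2 _)
      (primrecPred_label hq' hi _))).and <|
    primrecPred_imp (Primrec.nat_le.comp (Primrec.const 12) hc)
      (primrecPred_iff (primrecPred_testBit ha (Primrec.nat_sub.comp hc (Primrec.const 12)))
        (primrecPred_const _))

theorem primrecPred_prevOK (hw : Primrec w) (first : Prop) (hq : Primrec q) (hq' : Primrec q')
    (hi : Primrec i) (b : Bool) : PrimrecPred fun x =>
      PrevOK (w x) first (label (q x)) (label (q' x)) (i x) b := by
  have hs := Primrec.succ.comp hi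
  have h2 := primrec_secondArg hw hi
  have hn {n : ℕ} {p : α → Prop} (hp : PrimrecPred p) :
      PrimrecPred fun x => (w x).getD (i x) 0 = n → p x :=
    primrecPred_imp (primrecPred_code hw hi) hp
  exact (hn (primrecPred_before _ _ (primrecPred_label hq' hs _))).and <|
    (hn (primrecPred_before _ _ (primrecPred_label hq' hs _))).and <|
    (hn (primrecPred_unroll _ (primrecPred_label hq hs _) (primrecPred_label hq h2 _)
      (primrecPred_before _ _ (primrecPred_label hq' hi _)))).and <|
    hn (primrecPred_unroll _ (primrecPred_label hq hs _) (primrecPred_label hq h2 _)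
      (primrecPred_before _ _ (primrecPred_label hq' hi _)))

theorem primrecPred_pending (hw : Primrec w) (hq : Primrec q) :
    PrimrecPred fun x => Pending (w x) (label (q x)) := by
  have hw' := hw.comp (Primrec.fst (α := α) (β := ℕ))
  have hq' := hq.comp (Primrec.fst (α := α) (β := ℕ))
  exact primrecPred_exists_lt (Primrec.list_length.comp hw) (primrecPred_exists_bool fun b =>
    (((primrecPred_code hw' Primrec.snd).and (primrecPred_const _)).or
      ((primrecPred_code hw' Primrec.snd).and (primrecPred_const _))).and
    ((primrecPred_label hq' Primrec.snd _).and
      (primrecPred_label hq' (primrec_secondArg hw' Primrec.snd) _).not))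

theorem primrecPred_tableauStep (hw : Primrec w) (ha : Primrec a) (hq : Primrec q)
    (hq' : Primrec q') : PrimrecPred fun x => TableauStep (w x) (a x) (q x) (q' x) := by
  have h1 := hw.comp (Primrec.fst (α := α) (β := ℕ))
  have h2 := ha.comp (Primrec.fst (α := α) (β := ℕ))
  have h3 := hq.comp (Primrec.fst (α := α) (β := ℕ))
  have h4 := hq'.comp (Primrec.fst (α := α) (β := ℕ))
  exact primrecPred_forall_lt (Primrec.list_length.comp hw) (primrecPred_forall_bool fun b =>
    (primrecPred_imp (primrecPred_label h3 Primrec.snd _)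
      (primrecPred_nextOK h1 h2 h3 h4 Primrec.snd b)).and
    (primrecPred_imp (primrecPred_label h4 Primrec.snd _)
      (primrecPred_prevOK h1 _ h4 h3 Primrec.snd b)))

theorem primrecPred_tableauStart (hw : Primrec w) (hq : Primrec q) :
    PrimrecPred fun x => TableauStart (w x) (q x) := by
  have h1 := hw.comp (Primrec.fst (α := α) (β := ℕ))
  have h2 := hq.comp (Primrec.fst (α := α) (β := ℕ))
  exact (primrecPred_label hq (Primrec.const 0) _).and
    (primrecPred_forall_lt (Primrec.list_length.comp hw) (primrecPred_forall_bool fun b =>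
      primrecPred_imp (primrecPred_label h2 Primrec.snd _)
        (primrecPred_prevOK h1 _ h2 h2 Primrec.snd b)))

theorem primrec_tableauSize : Primrec tableauSize :=
  primrec_two_pow (Primrec.nat_mul.comp (Primrec.const 2) Primrec.list_length)

theorem primrec_breakpointStep {n : α → ℕ} (hw : Primrec w) (hn : Primrec n) (ha : Primrec a) :
    Primrec fun x => breakpointStep (w x) (n x) (a x) := by
  have hM := primrec_tableauSize.comp hw
  have hM2 := primrec_two_pow hM
  have hmod := Primrec.nat_mod.comp hn hM2
  have hdiv := Primrec.nat_div.comp hn hM2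
  have f1 : Primrec fun x : α × ℕ => x.1 := Primrec.fst
  have f2 : Primrec fun x : (α × ℕ) × ℕ => x.1.1 := Primrec.fst.comp Primrec.fst
  have q1 : Primrec fun x : (α × ℕ) × ℕ => x.2 := Primrec.snd
  have q2 : Primrec fun x : (α × ℕ) × ℕ => x.1.2 := Primrec.snd.comp Primrec.fst
  have hstep := primrecPred_tableauStep (hw.comp f2) (ha.comp f2) q1 q2
  exact Primrec.nat_add.comp
    (primrec_bitMask hM (primrecPred_exists_lt (hM.comp f1)
      ((primrecPred_testBit (hmod.comp f2) q1).and hstep)))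
    (Primrec.nat_mul.comp hM2 (primrec_bitMask hM
      ((primrecPred_exists_lt (hM.comp f1)
        (((primrecPred_testBit (hdiv.comp f2) q1).or
          ((Primrec.eq.comp (hdiv.comp f2) (Primrec.const 0)).and
            (primrecPred_testBit (hmod.comp f2) q1))).and hstep)).and
        (primrecPred_pending (hw.comp f1) Primrec.snd).not)))

theorem primrec_compileWord : Primrec₂ compileWord := by
  have hw : Primrec fun x : ℕ × List ℕ => x.2 := Primrec.snd
  have hM := primrec_tableauSize.comp hw
  have hM2 := primrec_two_pow hM
  have hN := Primrec.nat_mul.comp hM2 hM2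
  have hstart : Primrec fun x : ℕ × List ℕ => bitMask (tableauSize x.2) (TableauStart x.2) :=
    primrec_bitMask hM (primrecPred_tableauStart (hw.comp Primrec.fst) Primrec.snd)
  have htable : Primrec fun x : ℕ × List ℕ =>
      (List.range (2 ^ tableauSize x.2 * 2 ^ tableauSize x.2)).map fun n =>
        (List.range (2 ^ x.1)).map fun a => breakpointStep x.2 n a := by
    refine Primrec.list_map (Primrec.list_range.comp hN) (Primrec.list_map
      (Primrec.list_range.comp (primrec_two_pow (Primrec.fst.comp Primrec.fst))) ?_)
    exact primrec_breakpointStep (hw.comp (Primrec.fst.comp Primrec.fst))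
      (Primrec.snd.comp Primrec.fst) Primrec.snd
  exact Primrec.pair (Primrec.nat_sub.comp hN (Primrec.const 1))
    (Primrec.pair hstart (Primrec.pair htable (Primrec.list_range.comp hM2)))

end Computability

/-! ### The product automaton -/

variable {V : Type*}

theorem LTL.IsConj.sat_iff {l : List (LTL V)} {A : LTL V} (h : LTL.IsConj l A) (π : ℕ → Set V)
    (t : ℕ) : LTL.sat π t A ↔ ∀ φ ∈ l, LTL.sat π t φ := by
  induction h with
  | single φ => simp
  | conj _ _ ih ih' => simp [LTL.sat, ih, ih', or_imp, forall_and]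

theorem LTL.IsConj.forall_of_conj {p : LTL V → Prop}
    (hp : ∀ φ ψ, p (.conj φ ψ) → p φ ∧ p ψ) {l : List (LTL V)} {A : LTL V}
    (h : LTL.IsConj l A) (hA : p A) : ∀ φ ∈ l, p φ := by
  induction h with
  | single φ => simpa using hA
  | conj _ _ ih ih' =>
    have := hp _ _ hA
    intro φ hφ
    exact (List.mem_append.1 hφ).elim (ih this.1 φ) (ih' this.2 φ)

theorem Derives.prefix_of_conj {φ ψ : LTL V} (h : Derives .Prefix (.conj φ ψ)) :
    Derives .Prefix φ ∧ Derives .Prefix ψ := by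
  cases h with
  | Prefix_G h => cases h with | G_conj h h' => exact ⟨.Prefix_G h, .Prefix_G h'⟩
  | Prefix_F h => cases h with | F_conj h h' => exact ⟨.Prefix_F h, .Prefix_F h'⟩
  | Prefix_conj h h' => exact ⟨h, h'⟩

/-- The conjunction may have been derived inside `Prefix`, `G` or `F`, whose conjuncts are again in
`GF`. This matters because the given list of conjuncts may split further than the derivation from
`Assume` or `Guarantee` does. -/
theorem Derives.GF_of_conj {φ ψ : LTL V} (h : Derives .GF (.conj φ ψ)) :
    Derives .GF φ ∧ Derives .GF ψ := by
  cases h with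
  | GF_prefix h => exact h.prefix_of_conj.imp .GF_prefix .GF_prefix
  | GF_conj h h' => exact ⟨h, h'⟩

/-- Since `GF` is closed under conjunction, these two nonterminals add nothing to it. -/
theorem Derives.GF_of_assume_or_guarantee {P : Nonterminal} {φ : LTL V} (h : Derives P φ)
    (hP : P = .Assume ∨ P = .Guarantee) : Derives .GF φ := by
  induction h with
  | Assume_GF h | Guarantee_GF h => exact h
  | Assume_conj _ _ h h' | Guarantee_conj _ _ h h' => exact .GF_conj (h hP) (h' hP)
  | _ => simp at hP

namespace OmegaAutomaton

/-- The run of a deterministic automaton. -/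
def detRun {Q A : Type*} (q₀ : Q) (δ : Q → A → Q) (α : ℕ → A) : ℕ → Q
  | 0 => q₀
  | t + 1 => δ (detRun q₀ δ α t) (α t)

theorem accepts_ofFun {Q A : Type*} [Finite Q] (q₀ : Q) (δ : Q → A → Q) (acc : (ℕ → Q) → Prop)
    (α : ℕ → A) : (ofFun q₀ δ acc).Accepts α ↔ acc (detRun q₀ δ α) := by
  constructor
  · rintro ⟨β, ⟨h0, h⟩, hacc⟩
    obtain rfl : β = detRun q₀ δ α := by
      funext t
      induction t with
      | zero => exact h0
      | succ t ih => rw [detRun, ← ih]; exact h t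
    exact hacc
  · exact fun h => ⟨detRun q₀ δ α, ⟨rfl, fun _ => rfl⟩, h⟩

end OmegaAutomaton

/-- By determinism the only run of the product is the tuple of the component runs. -/
theorem gr1Automaton_accepts_iff {A : Type*} {n m : ℕ} {Qa : Fin n → Type*} {Qg : Fin m → Type*}
    [∀ i, Finite (Qa i)] [∀ j, Finite (Qg j)]
    (Ma : ∀ i, DetBuchi (Qa i) A) (Mg : ∀ j, DetBuchi (Qg j) A) (α : ℕ → A) :
    (gr1Automaton Ma Mg).Accepts α ↔
      ((∀ i, (Ma i).toOmega.Accepts α) → ∀ j, (Mg j).toOmega.Accepts α) := by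
  have h (t : ℕ) : OmegaAutomaton.detRun
      ((fun i => (Ma i).start, fun j => (Mg j).start) : (∀ i, Qa i) × (∀ j, Qg j))
      (fun q a => (fun i => (Ma i).step (q.1 i) a, fun j => (Mg j).step (q.2 j) a)) α t =
      (fun i => OmegaAutomaton.detRun (Ma i).start (Ma i).step α t,
        fun j => OmegaAutomaton.detRun (Mg j).start (Mg j).step α t) := by
    induction t with
    | zero => rfl
    | succ t ih => rw [OmegaAutomaton.detRun, ih]; rfl
  simp only [gr1Automaton, DetBuchi.toOmega, OmegaAutomaton.accepts_ofFun, h]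

end

end GR1Fragment

/-- There is an algorithm `compile` that, given the number `k` of variables and a formula, outputs
a deterministic Büchi automaton, such that for every `P_GR(1)`-formula
`Φ = (φ₁ ∧ … ∧ φₙ) → (ψ₁ ∧ … ∧ ψₘ)` over any `k` variables, the formulas `φᵢ`, `ψⱼ` are in the class
`TL_GF`, the automata computed for them are initially equivalent to them, and the GR(1)-automaton
of these automata is initially equivalent to `Φ`. -/
theorem mainTheorem1 :
    ∃ compile : ℕ → List ℕ → GR1Fragment.BuchiTable, Computable₂ compile ∧
      ∀ (V : Type*) (k : ℕ) (e : V ≃ Fin k) (n m : ℕ)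
        (φ : Fin n → GR1Fragment.LTL V) (ψ : Fin m → GR1Fragment.LTL V) (A B Φ : GR1Fragment.LTL V),
        GR1Fragment.LTL.IsConj (List.ofFn φ) A → GR1Fragment.LTL.IsConj (List.ofFn ψ) B → Φ = GR1Fragment.LTL.imp A B →
        GR1Fragment.Derives GR1Fragment.Nonterminal.GR1 Φ →
        (∀ i, GR1Fragment.Derives GR1Fragment.Nonterminal.GF (φ i)) ∧
        (∀ j, GR1Fragment.Derives GR1Fragment.Nonterminal.GF (ψ j)) ∧
        (∀ i, (GR1Fragment.BuchiTable.toDetBuchi e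
            (compile k ((φ i).toWord e))).toOmega.InitiallyEquivalent (φ i)) ∧
        (∀ j, (GR1Fragment.BuchiTable.toDetBuchi e
            (compile k ((ψ j).toWord e))).toOmega.InitiallyEquivalent (ψ j)) ∧
        (GR1Fragment.gr1Automaton
          (fun i => GR1Fragment.BuchiTable.toDetBuchi e (compile k ((φ i).toWord e)))
          (fun j => GR1Fragment.BuchiTable.toDetBuchi e
            (compile k ((ψ j).toWord e)))).InitiallyEquivalent Φ := by
  open GR1Fragment in
  refine ⟨compileWord, primrec_compileWord.to_comp, ?_⟩
  rintro V k e n m φ ψ A B Φ hA hB rfl hΦ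
  obtain ⟨hA', hB'⟩ : Derives .Assume A ∧ Derives .Guarantee B := by
    cases hΦ with | GR1_imp h h' => exact ⟨h, h'⟩
  have hφ (i : Fin n) : Derives .GF (φ i) :=
    hA.forall_of_conj (fun _ _ => Derives.GF_of_conj)
      (hA'.GF_of_assume_or_guarantee (.inl rfl)) _ (List.mem_ofFn.2 ⟨i, rfl⟩)
  have hψ (j : Fin m) : Derives .GF (ψ j) :=
    hB.forall_of_conj (fun _ _ => Derives.GF_of_conj)
      (hB'.GF_of_assume_or_guarantee (.inr rfl)) _ (List.mem_ofFn.2 ⟨j, rfl⟩)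
  have ha (i : Fin n) := compileWord_initiallyEquivalent e (hφ i)
  have hg (j : Fin m) := compileWord_initiallyEquivalent e (hψ j)
  refine ⟨hφ, hψ, ha, hg, fun α => ?_⟩
  rw [gr1Automaton_accepts_iff, LTL.imp, LTL.sat, LTL.sat, hA.sat_iff, hB.sat_iff,
    ← imp_iff_not_or]
  simp only [List.forall_mem_ofFn_iff]
  exact imp_congr (forall_congr' fun i => ha i α) (forall_congr' fun j => hg j α)
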